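/- Let $\mathcal S'(\mathbb R)$ be the dual of the space $\mathcal S(\mathbb R)$ of real Schwartz functions, equipped with the cylinder $\sigma$-algebra, and let $\nu$ be the white noise measure on it, i.e. the unique probability measure with $$\int_{\mathcal S'(\mathbb R)} e^{i\langle\omega,\xi\rangle}\,d\nu(\omega)=e^{-\frac12\int_{\mathbb R}\xi(x)^2dx},\qquad \xi\in\mathcal S(\mathbb R).$$ For $f\in L^2(\mathbb R)$ let $\langle\cdot,f\rangle\in L^2(\nu)$ denote the value at $f$ of the unique continuous linear extension to $L^2(\mathbb R)$ of $\xi\mapsto\langle\cdot,\xi\rangle$. For $\gamma>0$ and $x>0$ let $$({}^H\mathcal I_-^{\gamma}f)(x)=\frac1{\Gamma(\gamma)}\int_x^\infty\Big(\log\frac zx\Big)^{\gamma-1}\frac{f(z)}z\,dz ,$$ and for $0<\gamma<1$ let $$({}^H\mathcal D_-^{\gamma}f)(x)=-x\frac{d}{dx}({}^H\mathcal I_-^{1-\gamma}f)(x).$$ For $0<\alpha<2$ the Hadamard fractional Brownian motion (H-fBm) is the process $B^H_\alpha(t)=\langle\cdot,{}^H\mathcal M_-^{\alpha/2}1_{[0,t)}\rangle$,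 $t\ge0$, on $(\mathcal S'(\mathbb R),\nu)$, where, with $K_\alpha=\Gamma(\frac{\alpha+1}2)/\sqrt{\Gamma(\alpha)}$, for $x>0$, $${}^H\mathcal M_-^{\alpha/2}f=\begin{cases}K_\alpha\,{}^H\mathcal D_-^{(1-\alpha)/2}f,&\alpha\in(0,1),\\ f,&\alpha=1,\\ K_\alpha\,{}^H\mathcal I_-^{(\alpha-1)/2}f,&\alpha\in(1,2),\end{cases}$$ and ${}^H\mathcal M_-^{\alpha/2}f=0$ on $(-\infty,0]$. Let $C_\alpha=2^{1-\alpha}\sqrt\pi/\Gamma(\alpha/2)$ and, for $b\notin\mathbb Z$ and $z\ge0$, let $$\Psi(a,b;z)=\frac{\Gamma(1-b)}{\Gamma(1+a-b)}\Phi(a,b;z)+\frac{\Gamma(b-1)}{\Gamma(a)}z^{1-b}\Phi(1+a-b,2-b;z),\qquad \Phi(a,b;z)=\sum_{l\ge0}\frac{(a)_l}{(b)_l}\frac{z^l}{l!},$$ be Tricomi's confluent hypergeometric function, where $(c)_l=c(c+1)\cdots(c+l-1)$. Let $0<\alpha<2$. Then the following hold. 1. $B^H_\alpha$ is self-similar with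 index $1/2$: for every $a>0$ the processes $\{B^H_\alpha(at)\}_{t\ge0}$ and $\{a^{1/2}B^H_\alpha(t)\}_{t\ge0}$ have the same finite-dimensional distributions. 2. If $\alpha\ne1$, then $B^H_\alpha$ has non-stationary increments: there are $0\le s\le t$ and $h\ge0$ such that $B^H_\alpha(t+h)-B^H_\alpha(s+h)$ and $B^H_\alpha(t)-B^H_\alpha(s)$ have different laws. 3. If $\alpha\ne1$, then for all $k\in\mathbb R$ and $s,t\ge0$ $$\mathbb E\,e^{ik(B^H_\alpha(t)-B^H_\alpha(s))}=\exp\Big\{-\frac{k^2}2\Big[t+s-2C_\alpha(t\wedge s)\,\Psi\Big(\frac{1-\alpha}2,1-\alpha;\log\frac{t\vee s}{t\wedge s}\Big)\Big]\Big\},$$ where the term containing $\Psi$ is read as $0$ if $t\wedge s=0$. 4. For all $0\le u<v\le s<t$, the covariance of $B^H_\alpha(t)-B^H_\alpha(s)$ and $B^H_\alpha(v)-B^H_\alpha(u)$ is strictly negative if $\alpha\in(0,1)$ and strictly positive if $\alpha\in(1,2)$. -/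

import Mathlib

open MeasureTheory ProbabilityTheory
open scoped NNReal ENNReal

noncomputable section

namespace HadamardFBM

open SchwartzMap

/-! ### Right-sided Hadamard operators -/

/-- The right-sided Hadamard fractional integral of order `γ > 0`,
`(1 / Γ(γ)) ∫_x^∞ (log (z / x)) ^ (γ - 1) f(z) dz / z`, for `x > 0`. -/
def hadamardIntegral (γ : ℝ) (f : ℝ → ℝ) (x : ℝ) : ℝ :=
  (1 / Real.Gamma γ) * ∫ z in Set.Ioi x, Real.log (z / x) ^ (γ - 1) * (f z / z)

/-- The right-sided Hadamard fractional derivative of non-integer order `γ > 0`,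
`(-x d/dx)^n` applied to the Hadamard integral of order `n - γ`, where `n = ⌊γ⌋ + 1`. -/
def hadamardDerivative (γ : ℝ) (f : ℝ → ℝ) : ℝ → ℝ :=
  (fun g : ℝ → ℝ => fun x : ℝ => -x * deriv g x)^[⌊γ⌋₊ + 1]
    (hadamardIntegral ((⌊γ⌋₊ + 1 : ℕ) - γ) f)

/-- The normalizing constant `K_α = Γ((α + 1) / 2) / √Γ(α)`. -/
def Kconst (α : ℝ) : ℝ := Real.Gamma ((α + 1) / 2) / Real.sqrt (Real.Gamma α)

/-- The operator `M_-^{α/2}`, for `0 < α < 2`; the resulting function on `(0, ∞)` is extended by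
zero to the real line. -/
def hadamardM (α : ℝ) (f : ℝ → ℝ) (x : ℝ) : ℝ :=
  if x ≤ 0 then 0
  else if α < 1 then Kconst α * hadamardDerivative ((1 - α) / 2) f x
  else if α = 1 then f x
  else Kconst α * hadamardIntegral ((α - 1) / 2) f x

/-! ### Tricomi's function -/

/-- Kummer's function `Φ(a, b; z) = ∑ (a)_l / (b)_l * z ^ l / l!`, with `(c)_l` the rising
factorial. -/
def kummerPhi (a b z : ℝ) : ℝ :=
  ∑' l : ℕ, (ascPochhammer ℝ l).eval a / (ascPochhammer ℝ l).eval b * (z ^ l / (l.factorial : ℝ))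

/-- Tricomi's confluent hypergeometric function `Ψ(a, b; z)`, for non-integer `b` and `z ≥ 0`. -/
def tricomiPsi (a b z : ℝ) : ℝ :=
  Real.Gamma (1 - b) / Real.Gamma (1 + a - b) * kummerPhi a b z
    + Real.Gamma (b - 1) / Real.Gamma a * z ^ (1 - b) * kummerPhi (1 + a - b) (2 - b) z

/-- The constant `C_α = 2 ^ (1 - α) √π / Γ(α / 2)`. -/
def Cconst (α : ℝ) : ℝ := (2 : ℝ) ^ (1 - α) * Real.sqrt Real.pi / Real.Gamma (α / 2)

/-! ### White noise space -/

/-- The space `𝓢'(ℝ)` of real tempered distributions. -/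
abbrev TemperedDual : Type := 𝓢(ℝ, ℝ) →L[ℝ] ℝ

/-- The cylinder σ-algebra on `𝓢'(ℝ)`, generated by the evaluations `ω ↦ ⟨ω, ξ⟩`. -/
instance instMeasurableSpaceTemperedDual : MeasurableSpace TemperedDual :=
  ⨆ ξ : 𝓢(ℝ, ℝ), MeasurableSpace.comap (fun ω : TemperedDual => ω ξ) (borel ℝ)

/-- `ν` is the white noise measure on `𝓢'(ℝ)`: the probability measure with characteristic
functional `exp (-⟨ξ, ξ⟩ / 2)`. -/
structure IsWhiteNoise (ν : Measure TemperedDual) : Prop where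
  isProbabilityMeasure : IsProbabilityMeasure ν
  charFunctional : ∀ ξ : 𝓢(ℝ, ℝ),
    ∫ ω, Complex.exp (Complex.I * ((ω ξ : ℝ) : ℂ)) ∂ν
      = Complex.exp (-(1 / 2) * ((∫ x, ξ x * ξ x : ℝ) : ℂ))

theorem measurable_eval (ξ : 𝓢(ℝ, ℝ)) : Measurable (fun ω : TemperedDual => ω ξ) := by
  have h : MeasurableSpace.comap (fun ω : TemperedDual => ω ξ) (borel ℝ)
      ≤ instMeasurableSpaceTemperedDual :=
    le_iSup (fun ξ : 𝓢(ℝ, ℝ) =>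
      MeasurableSpace.comap (fun ω : TemperedDual => ω ξ) (borel ℝ)) ξ
  intro s hs
  refine h _ ⟨s, ?_, rfl⟩
  rwa [← BorelSpace.measurable_eq (α := ℝ)]

theorem IsWhiteNoise.map_eval {ν : Measure TemperedDual} (hν : IsWhiteNoise ν) (ξ : 𝓢(ℝ, ℝ)) :
    ν.map (fun ω : TemperedDual => ω ξ)
      = gaussianReal 0 (∫ x, ξ x * ξ x).toNNReal := by
  have := hν.isProbabilityMeasure
  have : IsProbabilityMeasure (ν.map (fun ω : TemperedDual => ω ξ)) :=
    Measure.isProbabilityMeasure_map (measurable_eval ξ).aemeasurable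
  have hpos : 0 ≤ ∫ x, ξ x * ξ x := integral_nonneg fun x => mul_self_nonneg _
  refine Measure.ext_of_charFun (funext fun t => ?_)
  rw [charFun_gaussianReal, charFun_apply_real,
    integral_map (measurable_eval ξ).aemeasurable (by fun_prop)]
  have h := hν.charFunctional (t • ξ)
  have h2 : ∫ x, (t • ξ) x * (t • ξ) x = t ^ 2 * ∫ x, ξ x * ξ x := by
    rw [← integral_const_mul]
    congr 1
    funext x
    simp only [smul_apply, smul_eq_mul]
    ring
  rw [h2] at h
  rw [Real.coe_toNNReal _ hpos]
  convert h using 1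
  · congr 1
    funext ω
    congr 1
    simp only [map_smul, smul_eq_mul]
    push_cast
    ring
  · congr 1
    push_cast
    ring

theorem IsWhiteNoise.memLp_eval {ν : Measure TemperedDual} (hν : IsWhiteNoise ν)
    (ξ : 𝓢(ℝ, ℝ)) : MemLp (fun ω : TemperedDual => ω ξ) 2 ν := by
  have h : MemLp id 2 (ν.map (fun ω : TemperedDual => ω ξ)) := by
    rw [hν.map_eval ξ]
    exact memLp_id_gaussianReal' 2 (by simp)
  exact (memLp_map_measure_iff (by fun_prop) (measurable_eval ξ).aemeasurable).1 h

/-- The linear map `ξ ↦ X(ξ) = ⟨·, ξ⟩` from Schwartz functions to `L²(ν)`. -/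
def evalLp {ν : Measure TemperedDual} (hν : IsWhiteNoise ν) : 𝓢(ℝ, ℝ) →ₗ[ℝ] Lp ℝ 2 ν where
  toFun ξ := (hν.memLp_eval ξ).toLp _
  map_add' ξ η := by
    rw [← MemLp.toLp_add]
    congr 1
    funext ω
    simp
  map_smul' c ξ := by
    rw [RingHom.id_apply, ← MemLp.toLp_const_smul]
    congr 1
    funext ω
    simp

/-- The extension of `ξ ↦ ⟨·, ξ⟩` to a continuous linear map from `L²(ℝ)` to `L²(ν)`. -/
def pairingLp {ν : Measure TemperedDual} (hν : IsWhiteNoise ν) :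
    Lp ℝ 2 (volume : Measure ℝ) →L[ℝ] Lp ℝ 2 ν :=
  (evalLp hν).extendOfNorm (SchwartzMap.toLpCLM ℝ ℝ 2 (volume : Measure ℝ)).toLinearMap

theorem norm_evalLp {ν : Measure TemperedDual} (hν : IsWhiteNoise ν) (ξ : 𝓢(ℝ, ℝ)) :
    ‖evalLp hν ξ‖ = ‖SchwartzMap.toLpCLM ℝ ℝ 2 (volume : Measure ℝ) ξ‖ := by
  have hpos : 0 ≤ ∫ x, ξ x * ξ x := integral_nonneg fun x => mul_self_nonneg _
  have e1 : ‖evalLp hν ξ‖ ^ 2 = ∫ x, ξ x * ξ x := by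
    rw [← real_inner_self_eq_norm_sq, L2.inner_def]
    have : (fun ω => inner ℝ ((evalLp hν ξ) ω) ((evalLp hν ξ) ω))
        =ᵐ[ν] fun ω => (fun y : ℝ => y ^ 2) ((fun ω : TemperedDual => ω ξ) ω) := by
      filter_upwards [(hν.memLp_eval ξ).coeFn_toLp] with ω hω
      have : (evalLp hν ξ) ω = ω ξ := hω
      simp [this, pow_two]
    rw [integral_congr_ae this,
      ← integral_map (f := fun y : ℝ => y ^ 2) (measurable_eval ξ).aemeasurable (by fun_prop),
      hν.map_eval ξ]
    have hv := variance_id_gaussianReal (μ := 0) (v := (∫ x, ξ x * ξ x).toNNReal)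
    rw [variance_of_integral_eq_zero (by fun_prop) (by simp)] at hv
    rw [Real.coe_toNNReal _ hpos] at hv
    simpa using hv
  have e2 : ‖SchwartzMap.toLpCLM ℝ ℝ 2 (volume : Measure ℝ) ξ‖ ^ 2 = ∫ x, ξ x * ξ x := by
    rw [← real_inner_self_eq_norm_sq, L2.inner_def]
    refine integral_congr_ae ?_
    filter_upwards [ξ.coeFn_toLp 2 (volume : Measure ℝ)] with x hx
    rw [SchwartzMap.toLpCLM_apply, hx]
    simp [pow_two]
  exact (pow_left_inj₀ (norm_nonneg _) (norm_nonneg _) two_ne_zero).1 (e1.trans e2.symm)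

theorem pairingLp_toLp {ν : Measure TemperedDual} (hν : IsWhiteNoise ν) (ξ : 𝓢(ℝ, ℝ)) :
    pairingLp hν (ξ.toLp 2 volume) = (hν.memLp_eval ξ).toLp _ :=
  LinearMap.extendOfNorm_eq (f := evalLp hν)
    (e := (SchwartzMap.toLpCLM ℝ ℝ 2 (volume : Measure ℝ)).toLinearMap)
    (SchwartzMap.denseRange_toLpCLM (by simp)) ⟨1, fun ξ => by
      rw [one_mul]; exact (norm_evalLp hν ξ).le⟩ ξ

open Classical in
/-- The random variable `ω ↦ ⟨ω, f⟩` for `f ∈ L²(ℝ)`, a representative of its `ν`-a.e. class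
(and zero if `f` is not in `L²(ℝ)`). -/
def pairing {ν : Measure TemperedDual} (hν : IsWhiteNoise ν) (f : ℝ → ℝ) (ω : TemperedDual) : ℝ :=
  if hf : MemLp f 2 (volume : Measure ℝ) then pairingLp hν (hf.toLp f) ω else 0

/-- The Hadamard fractional Brownian motion
`B_α^H(t, ω) = ⟨ω, M_-^{α/2} 1_{[0, t)}⟩` on the white noise space. -/
def hadamardFBm {ν : Measure TemperedDual} (hν : IsWhiteNoise ν) (α : ℝ) (t : ℝ≥0)
    (ω : TemperedDual) : ℝ :=
  pairing hν (hadamardM α ((Set.Ico (0 : ℝ) t).indicator fun _ => 1)) ω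

/-! ### Properties of real-valued processes -/

/-- Self-similarity with index `H`: for every `a > 0`, the processes `(X (a t))` and `(a ^ H X t)`
have the same finite-dimensional distributions. -/
def IsSelfSimilar {Ω : Type*} [MeasurableSpace Ω] (X : ℝ≥0 → Ω → ℝ) (H : ℝ) (P : Measure Ω) :
    Prop :=
  ∀ a : ℝ≥0, 0 < a → ∀ I : Finset ℝ≥0,
    IdentDistrib (fun ω => I.restrict fun t => X (a * t) ω)
      (fun ω => I.restrict fun t => (a : ℝ) ^ H * X t ω) P P

/-- Stationarity of the increments, in the weak one-dimensional sense: the law of an increment is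
invariant under time shifts. It is implied by the invariance under time shifts of the joint laws of
increments, so that its failure is the stronger form of non-stationarity. -/
def HasStationaryIncrements {Ω : Type*} [MeasurableSpace Ω] (X : ℝ≥0 → Ω → ℝ) (P : Measure Ω) :
    Prop :=
  ∀ s t h : ℝ≥0, s ≤ t →
    IdentDistrib (fun ω => X (t + h) ω - X (s + h) ω) (fun ω => X t ω - X s ω) P P

end HadamardFBM

end

/-! Everything is read off from the covariance. The map `f ↦ ⟨·, f⟩` is a linear isometry of `L²(ℝ)`
into `L²(ν)`, and `E exp(iX)` depends continuously on `X ∈ L²`, so the Gaussian characteristic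
functional passes from Schwartz functions to all of `L²(ℝ)`. The finite-dimensional laws are thus
determined by inner products of kernels.

In all three ranges of `α` the kernel `M 1_{[0,t)}` is a.e. `Γ(α)^{-1/2} log(t/x)^β` on `(0, t)`,
with `β = (α - 1)/2`. The substitution `x = s e^{-r}` then gives, for `s ≤ t`, the covariance `s
ρ(log(t/s))`, where `ρ(L) = Γ(α)⁻¹ ∫_0^∞ r^β (r + L)^β e^{-r} dr` (`inner_fbmKernel`). It is
homogeneous of degree one, which is self-similarity with index `1/2`. If `α ≠ 1`, then `ρ(L) ≠ ρ(0)
= 1` for `L > 0`, which rules out stationary increments. For disjoint increments the covariance is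
`v (ρ(m+L) - ρ(m)) - u (ρ(m'+L) - ρ(m'))` with `m ≤ m'`; its sign is that of `β`, because the
differences of `ρ` divided by `β` are positive and nonincreasing in `m` (`sign_mul_covariance_pos`).

The formula with `Ψ` requires `∫_0^∞ u^{a-b} (u+z)^{-a} e^{-u} du = Γ(1+a-b) Ψ(a,b;z)` for `a =
(1-α)/2`, `b = 1-α`. For `0 < b < 1` both sides solve Kummer's equation, and they have the same
value and the same limit of the quasi-derivative `z^b e^{-z} F'` at `0`; a Wronskian argument gives
uniqueness at this singular point. For `-1 < b < 0` the derivatives of both sides are given by the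
case `(a+1, b+1)`. -/

namespace HadamardFBM

open SchwartzMap

/-! ### The Gaussian isometry from `L²(ℝ)` to `L²(ν)` -/

section Pairing

variable {ν : Measure TemperedDual} (hν : IsWhiteNoise ν)

theorem denseRange_toLpCLM_two :
    DenseRange (SchwartzMap.toLpCLM ℝ ℝ 2 (volume : Measure ℝ)) :=
  SchwartzMap.denseRange_toLpCLM (by simp)

theorem pairingLp_toLpCLM (ξ : 𝓢(ℝ, ℝ)) :
    pairingLp hν (SchwartzMap.toLpCLM ℝ ℝ 2 (volume : Measure ℝ) ξ) = evalLp hν ξ :=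
  pairingLp_toLp hν ξ

theorem norm_pairingLp (F : Lp ℝ 2 (volume : Measure ℝ)) : ‖pairingLp hν F‖ = ‖F‖ := by
  refine denseRange_toLpCLM_two.induction_on F (isClosed_eq (by fun_prop) (by fun_prop)) fun ξ => ?_
  rw [pairingLp_toLpCLM, norm_evalLp]

theorem inner_pairingLp (F H : Lp ℝ 2 (volume : Measure ℝ)) :
    inner ℝ (pairingLp hν F) (pairingLp hν H) = inner ℝ F H :=
  LinearIsometry.inner_map_map ⟨(pairingLp hν).toLinearMap, norm_pairingLp hν⟩ F H

/-- The expectation of `exp (i X)` is a Lipschitz function of `X ∈ L²`. -/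
theorem lipschitzWith_integral_exp {Ω : Type*} [MeasurableSpace Ω] (P : Measure Ω)
    [IsProbabilityMeasure P] :
    LipschitzWith 1 fun X : Lp ℝ 2 P => ∫ ω, Complex.exp (Complex.I * ((X ω : ℝ) : ℂ)) ∂P := by
  refine LipschitzWith.of_dist_le_mul fun X Y => ?_
  have hint : ∀ Z : Lp ℝ 2 P,
      Integrable (fun ω => Complex.exp (Complex.I * ((Z ω : ℝ) : ℂ))) P := fun Z => by
    refine Integrable.of_bound (C := 1) ?_ (ae_of_all _ fun ω => ?_)
    · have := (Lp.aestronglyMeasurable Z)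
      exact (by fun_prop : Continuous fun x : ℝ =>
        Complex.exp (Complex.I * (x : ℂ))).comp_aestronglyMeasurable this
    · rw [Complex.norm_exp_I_mul_ofReal]
  have hXY : Integrable (fun ω => ‖(X - Y : Lp ℝ 2 P) ω‖) P :=
    ((Lp.memLp (X - Y)).integrable (by norm_num)).norm
  rw [dist_eq_norm, ← integral_sub (hint X) (hint Y), NNReal.coe_one, one_mul, dist_eq_norm]
  calc ‖∫ ω, (Complex.exp (Complex.I * ((X ω : ℝ) : ℂ)) - Complex.exp (Complex.I * ((Y ω : ℝ) : ℂ))) ∂P‖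
      ≤ ∫ ω, ‖(X - Y : Lp ℝ 2 P) ω‖ ∂P := by
        refine norm_integral_le_of_norm_le hXY ?_
        filter_upwards [Lp.coeFn_sub X Y] with ω hω
        rw [hω, Pi.sub_apply]
        -- With `exp(iY)` factored out, the bound `|exp(ix) - 1| ≤ |x|` applies pointwise; the `L¹`
        -- norm is then at most the `L²` norm because `P` is a probability measure.
        have h : Complex.exp (Complex.I * ((X ω : ℝ) : ℂ)) - Complex.exp (Complex.I * ((Y ω : ℝ) : ℂ))
            = Complex.exp (Complex.I * ((Y ω : ℝ) : ℂ)) *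
              (Complex.exp (Complex.I * ((X ω - Y ω : ℝ) : ℂ)) - 1) := by
          rw [mul_sub, ← Complex.exp_add]
          push_cast
          ring_nf
        rw [h, norm_mul, Complex.norm_exp_I_mul_ofReal, one_mul]
        exact Real.norm_exp_I_mul_ofReal_sub_one_le
    _ ≤ ‖X - Y‖ := by
        rw [integral_norm_eq_lintegral_enorm (Lp.aestronglyMeasurable _), ← eLpNorm_one_eq_lintegral_enorm,
          Lp.norm_def]
        exact ENNReal.toReal_mono (Lp.eLpNorm_ne_top _)
          (eLpNorm_le_eLpNorm_of_exponent_le (by norm_num) (Lp.aestronglyMeasurable _))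

/-- Both sides are continuous in `F`, the left one by `lipschitzWith_integral_exp`, so it suffices
to check Schwartz functions, where this is the definition of white noise. -/
theorem integral_exp_pairingLp (F : Lp ℝ 2 (volume : Measure ℝ)) :
    ∫ ω, Complex.exp (Complex.I * ((pairingLp hν F ω : ℝ) : ℂ)) ∂ν
      = Complex.exp (((-(‖F‖ ^ 2 / 2) : ℝ) : ℂ)) := by
  have := hν.isProbabilityMeasure
  refine denseRange_toLpCLM_two.induction_on F (isClosed_eq
    ((lipschitzWith_integral_exp ν).continuous.comp (pairingLp hν).continuous)
    (by fun_prop)) fun ξ => ?_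
  have h : ∫ x, ξ x * ξ x = ‖SchwartzMap.toLpCLM ℝ ℝ 2 (volume : Measure ℝ) ξ‖ ^ 2 := by
    rw [← real_inner_self_eq_norm_sq, L2.inner_def]
    refine integral_congr_ae ?_
    filter_upwards [ξ.coeFn_toLp 2 (volume : Measure ℝ)] with x hx
    rw [SchwartzMap.toLpCLM_apply, hx]
    simp [pow_two]
  rw [pairingLp_toLpCLM, ← h]
  have h2 := hν.charFunctional ξ
  have h3 : ∫ ω, Complex.exp (Complex.I * ((evalLp hν ξ ω : ℝ) : ℂ)) ∂ν
      = ∫ ω, Complex.exp (Complex.I * ((ω ξ : ℝ) : ℂ)) ∂ν := by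
    refine integral_congr_ae ?_
    filter_upwards [(hν.memLp_eval ξ).coeFn_toLp] with ω hω
    have : (evalLp hν ξ) ω = ω ξ := hω
    rw [this]
  rw [h3, h2]
  push_cast
  ring_nf

theorem integral_pairingLp (F : Lp ℝ 2 (volume : Measure ℝ)) :
    ∫ ω, pairingLp hν F ω ∂ν = 0 := by
  have := hν.isProbabilityMeasure
  have hm : AEMeasurable (pairingLp hν F) ν := (Lp.aestronglyMeasurable _).aemeasurable
  have : IsProbabilityMeasure (ν.map (pairingLp hν F)) := Measure.isProbabilityMeasure_map hm
  have hlaw : ν.map (pairingLp hν F) = gaussianReal 0 (‖F‖ ^ 2).toNNReal := by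
    refine Measure.ext_of_charFun (funext fun t => ?_)
    rw [charFun_gaussianReal, charFun_apply_real, integral_map hm (by fun_prop),
      Real.coe_toNNReal _ (sq_nonneg _)]
    -- By linearity the functional at `t • F` is the characteristic function at `t` of the variable
    -- attached to `F`, which is therefore a centred Gaussian.
    have h := integral_exp_pairingLp hν (t • F)
    have h2 : ∫ ω, Complex.exp (Complex.I * ((pairingLp hν (t • F) ω : ℝ) : ℂ)) ∂ν
        = ∫ ω, Complex.exp (t * (pairingLp hν F ω : ℂ) * Complex.I) ∂ν := by
      refine integral_congr_ae ?_
      rw [map_smul]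
      filter_upwards [Lp.coeFn_smul t (pairingLp hν F)] with ω hω
      rw [hω, Pi.smul_apply, smul_eq_mul]
      push_cast
      ring_nf
    rw [← h2, h, norm_smul, mul_pow, Real.norm_eq_abs, sq_abs]
    push_cast
    ring_nf
  have h := integral_map (f := fun x : ℝ => x) hm (by fun_prop)
  rw [← h, hlaw]
  simp

theorem covariance_pairingLp (F H : Lp ℝ 2 (volume : Measure ℝ)) :
    cov[pairingLp hν F, pairingLp hν H; ν] = inner ℝ F H := by
  rw [covariance, integral_pairingLp, integral_pairingLp, ← inner_pairingLp hν, L2.inner_def]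
  simp [mul_comm]

end Pairing

/-! ### The logarithmic kernel and its inner products -/

section Kernel

open Set Real

theorem image_mul_exp_Ioo {x t : ℝ} (hx : 0 < x) (hxt : x < t) :
    (fun r => x * exp r) '' Ioo 0 (log (t / x)) = Ioo x t := by
  have ht := hx.trans hxt
  ext z
  simp only [mem_image, mem_Ioo]
  constructor
  · rintro ⟨r, ⟨hr0, hr⟩, rfl⟩
    rw [lt_log_iff_exp_lt (by positivity), lt_div_iff₀ hx] at hr
    exact ⟨lt_mul_of_one_lt_right hx (one_lt_exp_iff.2 hr0), by linarith⟩
  · rintro ⟨h1, h2⟩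
    have hz := hx.trans h1
    refine ⟨log (z / x), ⟨log_pos ((one_lt_div hx).2 h1), log_lt_log (by positivity) (by gcongr)⟩, ?_⟩
    rw [exp_log (by positivity)]
    field_simp

theorem image_mul_exp_neg_Ioi {s : ℝ} (hs : 0 < s) :
    (fun r => s * exp (-r)) '' Ioi 0 = Ioo 0 s := by
  ext z
  simp only [mem_image, mem_Ioo, mem_Ioi]
  constructor
  · rintro ⟨r, hr, rfl⟩
    exact ⟨by positivity, mul_lt_of_lt_one_right hs (by simpa using hr)⟩
  · rintro ⟨h1, h2⟩
    refine ⟨log (s / z), log_pos ((one_lt_div h1).2 h2), ?_⟩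
    rw [exp_neg, exp_log (by positivity)]
    field_simp

theorem injective_mul_exp_neg {s : ℝ} (hs : 0 < s) :
    Function.Injective fun r : ℝ => s * exp (-r) := fun a b h => by
  have := mul_left_cancel₀ hs.ne' h
  simpa using this

theorem hasDerivAt_mul_exp_neg (s r : ℝ) :
    HasDerivAt (fun r : ℝ => s * exp (-r)) (-(s * exp (-r))) r := by
  have := ((hasDerivAt_id r).neg.exp).const_mul s
  simpa using this

theorem log_div_mul_exp_neg {s t : ℝ} (hs : 0 < s) (ht : 0 < t) (r : ℝ) :
    log (t / (s * exp (-r))) = r + log (t / s) := by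
  rw [exp_neg, show t / (s * (exp r)⁻¹) = exp r * (t / s) by field_simp,
    log_mul (exp_ne_zero _) (by positivity), log_exp]

/-- The Hadamard integral of the indicator of `[0, t)`. -/
theorem hadamardIntegral_indicator {γ : ℝ} (hγ : 0 < γ) (t : ℝ) {x : ℝ} (hx : 0 < x) :
    hadamardIntegral γ ((Ico (0 : ℝ) t).indicator fun _ => 1) x
      = if x < t then log (t / x) ^ γ / Gamma (γ + 1) else 0 := by
  have h1 : ∫ z in Ioi x, log (z / x) ^ (γ - 1) * ((Ico (0 : ℝ) t).indicator (fun _ => 1) z / z)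
      = ∫ z in Ioo x t, log (z / x) ^ (γ - 1) / z := by
    rw [← integral_indicator measurableSet_Ioi, ← integral_indicator measurableSet_Ioo]
    congr 1
    funext z
    by_cases hz : x < z
    · by_cases hzt : z < t
      · rw [indicator_of_mem (show z ∈ Ioi x from hz), indicator_of_mem (show z ∈ Ioo x t from ⟨hz, hzt⟩),
          indicator_of_mem (show z ∈ Ico 0 t from ⟨(hx.trans hz).le, hzt⟩)]
        ring
      · rw [indicator_of_mem (show z ∈ Ioi x from hz), indicator_of_notMem (fun h => hzt h.2),
          indicator_of_notMem (fun h => hzt h.2)]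
        simp
    · rw [indicator_of_notMem (show z ∉ Ioi x from hz), indicator_of_notMem (fun h => hz h.1)]
  rw [hadamardIntegral, h1]
  split_ifs with hxt
  · have hlog : 0 < log (t / x) := log_pos ((one_lt_div hx).2 hxt)
    -- The substitution `z = x e^r` cancels `dz / z` and leaves `∫ r^(γ-1) dr` over `(0, log(t/x))`.
    rw [← image_mul_exp_Ioo hx hxt, integral_image_eq_integral_abs_deriv_smul measurableSet_Ioo
      (fun r _ => ((hasDerivAt_exp r).const_mul x).hasDerivWithinAt)
      (fun a _ b _ h => exp_injective (mul_left_cancel₀ hx.ne' h))]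
    have h2 : ∀ r : ℝ, |x * exp r| • (log (x * exp r / x) ^ (γ - 1) / (x * exp r)) = r ^ (γ - 1) := by
      intro r
      rw [abs_of_pos (by positivity), mul_div_cancel_left₀ _ hx.ne', log_exp, smul_eq_mul]
      field_simp
    simp_rw [h2]
    rw [← integral_Ioc_eq_integral_Ioo, ← intervalIntegral.integral_of_le hlog.le,
      integral_rpow (Or.inl (by linarith)), Gamma_add_one hγ.ne']
    have : Gamma γ ≠ 0 := (Gamma_pos_of_pos hγ).ne'
    rw [sub_add_cancel, zero_rpow hγ.ne']
    field_simp
    ring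
  · rw [Ioo_eq_empty hxt]
    simp

/-- Near any `x ≠ t` the Hadamard integral of order `1 - γ` is either `log(t/y)^(1-γ) / Γ(2-γ)` or
zero. The chain rule factor `-1/x` cancels the `-x` of the operator, and `1 - γ` is absorbed by the
Gamma function. -/
theorem hadamardDerivative_indicator {γ : ℝ} (hγ1 : γ < 1) (t : ℝ) {x : ℝ} (hx : 0 < x)
    (hxt : x ≠ t) :
    hadamardDerivative γ ((Ico (0 : ℝ) t).indicator fun _ => 1) x
      = if x < t then log (t / x) ^ (-γ) / Gamma (1 - γ) else 0 := by
  have hfl : ⌊γ⌋₊ = 0 := Nat.floor_eq_zero.2 hγ1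
  rw [hadamardDerivative, hfl]
  simp only [zero_add, Function.iterate_one, Nat.cast_one]
  rcases lt_or_gt_of_ne hxt with h | h
  · rw [if_pos h]
    have ht := hx.trans h
    have hlog : 0 < log (t / x) := log_pos ((one_lt_div hx).2 h)
    have he : hadamardIntegral (1 - γ) ((Ico (0 : ℝ) t).indicator fun _ => 1)
        =ᶠ[nhds x] fun y => log (t / y) ^ (1 - γ) / Gamma (1 - γ + 1) := by
      filter_upwards [lt_mem_nhds hx, gt_mem_nhds h] with y hy hyt
      rw [hadamardIntegral_indicator (by linarith) t hy, if_pos hyt]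
    rw [he.deriv_eq]
    have hd : HasDerivAt (fun y => log (t / y)) (-1 / x) x := by
      have h1 : HasDerivAt (fun y => log t - log y) (-x⁻¹) x := by
        simpa using (hasDerivAt_log hx.ne').const_sub (log t)
      refine (h1.congr_of_eventuallyEq ?_).congr_deriv (by field_simp)
      filter_upwards [lt_mem_nhds hx] with y hy
      rw [log_div ht.ne' hy.ne']
    have hd2 := ((hd.rpow_const (p := 1 - γ) (Or.inl hlog.ne')).div_const (Gamma (1 - γ + 1))).deriv
    rw [hd2, Gamma_add_one (by linarith)]
    have : Gamma (1 - γ) ≠ 0 := (Gamma_pos_of_pos (by linarith)).ne'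
    have : 1 - γ ≠ 0 := by linarith
    rw [show 1 - γ - 1 = -γ by ring]
    field_simp
  · rw [if_neg h.not_gt]
    have he : hadamardIntegral (1 - γ) ((Ico (0 : ℝ) t).indicator fun _ => 1)
        =ᶠ[nhds x] fun _ => 0 := by
      filter_upwards [lt_mem_nhds hx, lt_mem_nhds h] with y hy hyt
      rw [hadamardIntegral_indicator (by linarith) t hy, if_neg hyt.not_gt]
    rw [he.deriv_eq]
    simp

/-- The logarithmic kernel `1_{(0, t)}(x) log (t / x) ^ β`. -/
noncomputable def logKernel (β t : ℝ) : ℝ → ℝ := (Ioo 0 t).indicator fun x => log (t / x) ^ β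

/-- The numerator `Γ((α+1)/2)` of `K_α` is exactly the Gamma factor produced by the fractional
integral or derivative, so the three cases merge into one formula. The point `x = t` is discarded as
a null set. -/
theorem hadamardM_indicator_ae {α : ℝ} (hα₀ : 0 < α) (t : ℝ) :
    hadamardM α ((Ico (0 : ℝ) t).indicator fun _ => 1)
      =ᵐ[volume] fun x => (1 / √(Gamma α)) * logKernel ((α - 1) / 2) t x := by
  have hne : ∀ᵐ x : ℝ, x ≠ t := by
    simp [ae_iff, measure_singleton]
  filter_upwards [hne] with x hxt
  have hΓ : Gamma ((α + 1) / 2) ≠ 0 := (Gamma_pos_of_pos (by linarith)).ne'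
  have hΓ' : √(Gamma α) ≠ 0 := (sqrt_pos.2 (Gamma_pos_of_pos hα₀)).ne'
  rw [hadamardM]
  split_ifs with h0 h1 h2
  · rw [logKernel, indicator_of_notMem (fun h => h.1.not_ge h0), mul_zero]
  · push Not at h0
    rw [hadamardDerivative_indicator (by linarith) t h0 hxt, logKernel, Kconst]
    rw [show 1 - (1 - α) / 2 = (α + 1) / 2 by ring, show -((1 - α) / 2) = (α - 1) / 2 by ring]
    split_ifs with hlt
    · rw [indicator_of_mem (show x ∈ Ioo 0 t from ⟨h0, hlt⟩)]
      field_simp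
    · rw [indicator_of_notMem (fun h => hlt h.2)]
      simp
  · push Not at h0
    subst h2
    by_cases hlt : x < t
    · rw [logKernel, indicator_of_mem (show x ∈ Ioo 0 t from ⟨h0, hlt⟩),
        indicator_of_mem (show x ∈ Ico 0 t from ⟨h0.le, hlt⟩)]
      simp
    · rw [logKernel, indicator_of_notMem (fun h => hlt h.2), indicator_of_notMem (fun h => hlt h.2)]
      simp
  · push Not at h0 h1
    have h3 : 1 < α := lt_of_le_of_ne h1 (Ne.symm h2)
    rw [hadamardIntegral_indicator (by linarith) t h0, logKernel, Kconst]
    rw [show (α - 1) / 2 + 1 = (α + 1) / 2 by ring]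
    split_ifs with hlt
    · rw [indicator_of_mem (show x ∈ Ioo 0 t from ⟨h0, hlt⟩)]
      field_simp
    · rw [indicator_of_notMem (fun h => hlt h.2)]
      simp

theorem logKernel_eq_zero_of_nonpos (β : ℝ) {t : ℝ} (ht : t ≤ 0) : logKernel β t = 0 := by
  rw [logKernel, Ioo_eq_empty ht.not_gt, indicator_empty]
  rfl

theorem measurable_logKernel (β t : ℝ) : Measurable (logKernel β t) :=
  Measurable.indicator (by fun_prop) measurableSet_Ioo

/-- Under `x = t e^{-r}` the squared norm becomes `t` times the Gamma integral of order `2β + 1`,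
hence the threshold `-1/2`. For `β = (α-1)/2` this is `α > 0`. -/
theorem memLp_logKernel {β : ℝ} (hβ : -(1 / 2) < β) (t : ℝ) : MemLp (logKernel β t) 2 volume := by
  rcases le_or_gt t 0 with ht | ht
  · rw [logKernel_eq_zero_of_nonpos β ht]
    exact MemLp.zero
  rw [memLp_two_iff_integrable_sq (measurable_logKernel β t).aestronglyMeasurable]
  have h : (fun x => logKernel β t x ^ 2) = (Ioo 0 t).indicator fun x => (log (t / x) ^ β) ^ 2 := by
    funext x
    by_cases hx : x ∈ Ioo 0 t
    · simp only [logKernel, indicator_of_mem hx]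
    · simp only [logKernel, indicator_of_notMem hx]
      simp
  rw [h, integrable_indicator_iff measurableSet_Ioo, ← image_mul_exp_neg_Ioi ht,
    integrableOn_image_iff_integrableOn_abs_deriv_smul measurableSet_Ioi
      (fun r _ => (hasDerivAt_mul_exp_neg t r).hasDerivWithinAt) (injective_mul_exp_neg ht).injOn]
  have hint := (GammaIntegral_convergent (s := 2 * β + 1) (by linarith)).const_mul t
  refine IntegrableOn.congr_fun hint (fun r hr => ?_) measurableSet_Ioi
  have hr : 0 < r := hr
  rw [log_div_mul_exp_neg ht ht, div_self ht.ne', log_one, add_zero, abs_neg,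
    abs_of_pos (by positivity), smul_eq_mul, ← rpow_natCast, ← rpow_mul hr.le,
    show 2 * β + 1 - 1 = β * (2 : ℕ) by push_cast; ring]
  ring

/-- Under `x = s e^{-r}` the two logarithms become `r` and `r + log(t/s)`, and the Jacobian is `s
e^{-r}`. -/
theorem integral_logKernel_mul (β : ℝ) {s t : ℝ} (hs : 0 < s) (hst : s ≤ t) :
    ∫ x, logKernel β s x * logKernel β t x
      = s * ∫ r in Ioi 0, r ^ β * (r + log (t / s)) ^ β * exp (-r) := by
  have h : (fun x => logKernel β s x * logKernel β t x)
      = (Ioo 0 s).indicator fun x => log (s / x) ^ β * log (t / x) ^ β := by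
    funext x
    by_cases hx : x ∈ Ioo 0 s
    · have hx' : x ∈ Ioo 0 t := ⟨hx.1, hx.2.trans_le hst⟩
      simp only [logKernel, indicator_of_mem hx, indicator_of_mem hx']
    · simp only [logKernel, indicator_of_notMem hx, zero_mul]
  rw [h, integral_indicator measurableSet_Ioo, ← image_mul_exp_neg_Ioi hs,
    integral_image_eq_integral_abs_deriv_smul measurableSet_Ioi
      (fun r _ => (hasDerivAt_mul_exp_neg s r).hasDerivWithinAt) (injective_mul_exp_neg hs).injOn,
    ← integral_const_mul]
  refine setIntegral_congr_fun measurableSet_Ioi fun r _ => ?_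
  rw [log_div_mul_exp_neg hs hs, log_div_mul_exp_neg hs (hs.trans_le hst), div_self hs.ne', log_one,
    add_zero, abs_neg, abs_of_pos (by positivity), smul_eq_mul]
  ring

end Kernel

/-! ### Kummer's series, contiguous relations and derivatives -/

section Kummer

open Real

/-- The exponential generating function `∑ c_l z ^ l / l!`. -/
noncomputable def expSeries (c : ℕ → ℝ) (z : ℝ) : ℝ := ∑' l : ℕ, c l * (z ^ l / (l.factorial : ℝ))

theorem summable_expSeries {c : ℕ → ℝ} {M : ℝ} (hc : ∀ l, |c l| ≤ M ^ l) (z : ℝ) :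
    Summable fun l : ℕ => c l * (z ^ l / (l.factorial : ℝ)) := by
  refine Summable.of_norm_bounded (Real.summable_pow_div_factorial (M * |z|)) fun l => ?_
  rw [norm_mul, norm_div, norm_pow, Real.norm_eq_abs, Real.norm_eq_abs, mul_pow, mul_div_assoc,
    RCLike.norm_natCast]
  gcongr
  exact hc l

theorem hasDerivAt_expSeries {c : ℕ → ℝ} {M : ℝ} (hc : ∀ l, |c l| ≤ M ^ l) (z : ℝ) :
    HasDerivAt (expSeries c) (expSeries (fun l => c (l + 1)) z) z := by
  -- On the ball of radius `R`, which contains both `0` and `z`, the differentiated series is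
  -- dominated uniformly.
  set R : ℝ := |z| + 1
  have hR : 0 ≤ R := by positivity
  have hterm : ∀ (k : ℝ) (l : ℕ) (y : ℝ),
      k * (((l + 1 : ℕ) : ℝ) * y ^ (l + 1 - 1) / ((l + 1).factorial : ℝ))
        = k * (y ^ l / (l.factorial : ℝ)) := fun k l y => by
    rw [Nat.factorial_succ, Nat.add_sub_cancel]
    push_cast
    have : ((l : ℝ) + 1) ≠ 0 := by positivity
    have : (l.factorial : ℝ) ≠ 0 := by positivity
    field_simp
  have hu : Summable fun l : ℕ => |c l| * ((l : ℝ) * R ^ (l - 1) / (l.factorial : ℝ)) := by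
    rw [← summable_nat_add_iff 1]
    refine Summable.of_nonneg_of_le (fun l => by positivity) (fun l => ?_)
      ((Real.summable_pow_div_factorial (M * R)).mul_left M)
    rw [hterm]
    calc |c (l + 1)| * (R ^ l / (l.factorial : ℝ)) ≤ M ^ (l + 1) * (R ^ l / (l.factorial : ℝ)) := by
          gcongr
          exact hc _
      _ = M * ((M * R) ^ l / (l.factorial : ℝ)) := by rw [mul_pow]; ring
  have h := hasDerivAt_tsum_of_isPreconnected
    (g := fun l y => c l * (y ^ l / (l.factorial : ℝ)))
    (g' := fun l y => c l * ((l : ℝ) * y ^ (l - 1) / (l.factorial : ℝ)))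
    (t := Metric.ball 0 R) (y₀ := z) (y := z) hu Metric.isOpen_ball
    (convex_ball 0 R).isPreconnected
    (fun l y _ => (((hasDerivAt_pow l y).div_const _).const_mul _)) ?_ ?_
    (summable_expSeries hc z) ?_
  · refine h.congr_deriv ?_
    rw [Summable.tsum_eq_zero_add, expSeries]
    · simp only [CharP.cast_eq_zero, zero_mul, zero_div, mul_zero, zero_add]
      exact tsum_congr fun l => hterm _ l z
    · refine Summable.of_norm_bounded hu fun l => ?_
      rw [norm_mul, norm_div, norm_mul, norm_pow, RCLike.norm_natCast, RCLike.norm_natCast,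
        Real.norm_eq_abs, Real.norm_eq_abs]
      gcongr
      simp [R]
  · intro l y hy
    rw [norm_mul, norm_div, norm_mul, norm_pow, RCLike.norm_natCast, RCLike.norm_natCast,
        Real.norm_eq_abs, Real.norm_eq_abs]
    have : |y| ≤ R := by simpa using (mem_ball_zero_iff.1 hy).le
    gcongr
  all_goals simp [R]

/-- Multiplication by `z` shifts the coefficients. At `l = 0` the truncated index `l - 1` is
harmless because of the factor `l`. -/
theorem hasSum_mul_expSeries {c : ℕ → ℝ} {M : ℝ} (hc : ∀ l, |c l| ≤ M ^ l) (z : ℝ) :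
    HasSum (fun l : ℕ => ((l : ℝ) * c (l - 1)) * (z ^ l / (l.factorial : ℝ))) (z * expSeries c z) := by
  rw [← hasSum_nat_add_iff' 1]
  simp only [Finset.range_one, Finset.sum_singleton, CharP.cast_eq_zero, zero_mul, sub_zero]
  refine ((summable_expSeries hc z).hasSum.mul_left z).congr_fun fun l => ?_
  rw [Nat.factorial_succ, Nat.add_sub_cancel]
  push_cast
  have : ((l : ℝ) + 1) ≠ 0 := by positivity
  have : (l.factorial : ℝ) ≠ 0 := by positivity
  field_simp
  ring

/-- The coefficients `(a)_l / (b)_l` of Kummer's function. -/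
noncomputable def kummerCoeff (a b : ℝ) (l : ℕ) : ℝ :=
  (ascPochhammer ℝ l).eval a / (ascPochhammer ℝ l).eval b

theorem kummerPhi_eq (a b : ℝ) : kummerPhi a b = expSeries (kummerCoeff a b) := rfl

theorem kummerCoeff_zero (a b : ℝ) : kummerCoeff a b 0 = 1 := by simp [kummerCoeff]

theorem kummerCoeff_succ (a b : ℝ) (l : ℕ) :
    kummerCoeff a b (l + 1) = kummerCoeff a b l * ((a + l) / (b + l)) := by
  simp only [kummerCoeff, ascPochhammer_succ_eval]
  rw [mul_div_mul_comm]

theorem ascPochhammer_eval_succ_left (a : ℝ) (l : ℕ) :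
    (ascPochhammer ℝ (l + 1)).eval a = a * (ascPochhammer ℝ l).eval (a + 1) := by
  rw [ascPochhammer_succ_left]
  simp

theorem kummerCoeff_succ' (a b : ℝ) (l : ℕ) :
    kummerCoeff a b (l + 1) = a / b * kummerCoeff (a + 1) (b + 1) l := by
  simp only [kummerCoeff, ascPochhammer_eval_succ_left]
  rw [mul_div_mul_comm]

/-- Consecutive coefficients have ratio `(a+l)/(b+l)`, which tends to `1` and is therefore bounded
by some `M`. -/
theorem exists_kummerCoeff_bound (a b : ℝ) : ∃ M : ℝ, ∀ l, |kummerCoeff a b l| ≤ M ^ l := by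
  have h : Filter.Tendsto (fun l : ℕ => (a + l) / (b + l)) Filter.atTop (nhds 1) := by
    have := tendsto_add_mul_div_add_mul_atTop_nhds a b (1 : ℝ) (d := 1) one_ne_zero
    simpa using this
  obtain ⟨M, hM⟩ := (Metric.isBounded_range_of_tendsto _ h).exists_norm_le
  have hM' : ∀ l : ℕ, |(a + l) / (b + l)| ≤ M := fun l => hM _ ⟨l, rfl⟩
  have hM0 : 0 ≤ M := (abs_nonneg _).trans (hM' 0)
  refine ⟨M, fun l => ?_⟩
  induction l with
  | zero => simp [kummerCoeff_zero]
  | succ l ih =>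
    rw [kummerCoeff_succ, abs_mul, pow_succ]
    exact mul_le_mul ih (hM' l) (abs_nonneg _) (by positivity)

theorem hasSum_kummerPhi (a b z : ℝ) :
    HasSum (fun l : ℕ => kummerCoeff a b l * (z ^ l / (l.factorial : ℝ))) (kummerPhi a b z) := by
  obtain ⟨M, hM⟩ := exists_kummerCoeff_bound a b
  exact (summable_expSeries hM z).hasSum

theorem hasSum_mul_kummerPhi (a b z : ℝ) :
    HasSum (fun l : ℕ => ((l : ℝ) * kummerCoeff a b (l - 1)) * (z ^ l / (l.factorial : ℝ)))
      (z * kummerPhi a b z) := by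
  obtain ⟨M, hM⟩ := exists_kummerCoeff_bound a b
  exact hasSum_mul_expSeries hM z

theorem hasDerivAt_kummerPhi (a b z : ℝ) :
    HasDerivAt (kummerPhi a b) (a / b * kummerPhi (a + 1) (b + 1) z) z := by
  obtain ⟨M, hM⟩ := exists_kummerCoeff_bound a b
  refine (hasDerivAt_expSeries hM z).congr_deriv ?_
  rw [kummerPhi_eq, expSeries, expSeries, ← tsum_mul_left]
  refine tsum_congr fun l => ?_
  rw [kummerCoeff_succ']
  ring

theorem continuous_kummerPhi (a b : ℝ) : Continuous (kummerPhi a b) :=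
  continuous_iff_continuousAt.2 fun z => (hasDerivAt_kummerPhi a b z).continuousAt

theorem kummerPhi_zero (a b : ℝ) : kummerPhi a b 0 = 1 := by
  rw [kummerPhi_eq, expSeries, tsum_eq_single 0]
  · simp [kummerCoeff_zero]
  · intro l hl
    simp [hl]

theorem kummerPhi_pos {a b z : ℝ} (ha : 0 < a) (hb : 0 < b) (hz : 0 ≤ z) : 0 < kummerPhi a b z := by
  have h := hasSum_kummerPhi a b z
  have hc : ∀ l, 0 ≤ kummerCoeff a b l := fun l =>
    div_nonneg (ascPochhammer_pos l a ha).le (ascPochhammer_pos l b hb).le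
  have := h.summable.le_tsum 0 fun l _ => mul_nonneg (hc l) (by positivity)
  rw [h.tsum_eq] at this
  simp only [kummerCoeff_zero, pow_zero, Nat.factorial_zero] at this
  norm_num at this
  linarith

/-- `b Φ(a + 1, b + 1) - z Φ(a + 1, b + 1) + z Φ'(a + 1, b + 1) = b Φ(a, b)`. -/
theorem kummerPhi_contiguous_lower {a b : ℝ} (hb : ∀ n : ℕ, b + n ≠ 0) (z : ℝ) :
    b * kummerPhi (a + 1) (b + 1) z - z * kummerPhi (a + 1) (b + 1) z
      + z * ((a + 1) / (b + 1) * kummerPhi (a + 1 + 1) (b + 1 + 1) z) = b * kummerPhi a b z := by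
  have h := (((hasSum_kummerPhi (a + 1) (b + 1) z).mul_left b).sub
    (hasSum_mul_kummerPhi (a + 1) (b + 1) z)).add
    ((hasSum_mul_kummerPhi (a + 1 + 1) (b + 1 + 1) z).mul_left ((a + 1) / (b + 1)))
  rw [← mul_left_comm] at h
  refine h.unique (((hasSum_kummerPhi a b z).mul_left b).congr_fun fun l => ?_)
  have hb0 : b ≠ 0 := by simpa using hb 0
  rcases l with _ | l
  · simp [kummerCoeff_zero]
  · have h1 : kummerCoeff (a + 1) (b + 1) (l + 1)
        = (a + 1) / (b + 1) * kummerCoeff (a + 1 + 1) (b + 1 + 1) l := kummerCoeff_succ' _ _ _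
    have h2 := kummerCoeff_succ (a + 1) (b + 1) l
    have h3 := kummerCoeff_succ' a b l
    have hbl := hb (l + 1)
    push_cast at hbl
    have hbl' : b + 1 + l ≠ 0 := by convert hbl using 1; ring
    simp only [Nat.add_sub_cancel]
    have h4 : b * kummerCoeff (a + 1) (b + 1) (l + 1)
        - ((l + 1 : ℕ) : ℝ) * kummerCoeff (a + 1) (b + 1) l
        + (((l + 1 : ℕ) : ℝ)) * ((a + 1) / (b + 1) * kummerCoeff (a + 1 + 1) (b + 1 + 1) l)
        = b * kummerCoeff a b (l + 1) := by
      rw [← h1, h2, h3]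
      push_cast
      field_simp
      ring
    rw [← mul_assoc b (kummerCoeff a b (l + 1)), ← h4]
    ring

/-- `(b - 1) Φ(a, b) + z Φ'(a, b) = (b - 1) Φ(a, b - 1)`. -/
theorem kummerPhi_contiguous_right {a b : ℝ} (hb : ∀ n : ℕ, b - 1 + n ≠ 0) (z : ℝ) :
    (b - 1) * kummerPhi a b z + z * (a / b * kummerPhi (a + 1) (b + 1) z)
      = (b - 1) * kummerPhi a (b - 1) z := by
  have h := ((hasSum_kummerPhi a b z).mul_left (b - 1)).add
    ((hasSum_mul_kummerPhi (a + 1) (b + 1) z).mul_left (a / b))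
  rw [← mul_left_comm] at h
  refine h.unique (((hasSum_kummerPhi a (b - 1) z).mul_left (b - 1)).congr_fun fun l => ?_)
  have h4 : ∀ l : ℕ, (b - 1 + l) * kummerCoeff a b l = (b - 1) * kummerCoeff a (b - 1) l := by
    intro l
    induction l with
    | zero => simp [kummerCoeff_zero]
    | succ l ih =>
      rw [kummerCoeff_succ, kummerCoeff_succ, ← mul_assoc (b - 1), ← ih]
      have h1 := hb (l + 1)
      have h2 := hb l
      push_cast at h1 ⊢
      have h3 : b + l ≠ 0 := by convert h1 using 1; ring
      field_simp
      ring
  have h5 : (b - 1) * kummerCoeff a b l + a / b * (l * kummerCoeff (a + 1) (b + 1) (l - 1))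
      = (b - 1) * kummerCoeff a (b - 1) l := by
    rw [← h4 l]
    rcases l with _ | l
    · simp
    · rw [Nat.add_sub_cancel, kummerCoeff_succ']
      ring
  rw [← mul_assoc (b - 1) (kummerCoeff a (b - 1) l), ← h5]
  ring

/-- `Φ'(a, b) - Φ(a, b) = -(b - a) / b Φ(a, b + 1)`. -/
theorem kummerPhi_contiguous_upper {a b : ℝ} (hb : ∀ n : ℕ, b + n ≠ 0) (z : ℝ) :
    a / b * kummerPhi (a + 1) (b + 1) z - kummerPhi a b z
      = -((b - a) / b) * kummerPhi a (b + 1) z := by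
  have h := ((hasSum_kummerPhi (a + 1) (b + 1) z).mul_left (a / b)).sub (hasSum_kummerPhi a b z)
  refine h.unique (((hasSum_kummerPhi a (b + 1) z).mul_left _).congr_fun fun l => ?_)
  have hb0 : b ≠ 0 := by simpa using hb 0
  have h4 : ∀ l : ℕ, b * kummerCoeff a b l = (b + l) * kummerCoeff a (b + 1) l := by
    intro l
    induction l with
    | zero => simp [kummerCoeff_zero]
    | succ l ih =>
      rw [kummerCoeff_succ, kummerCoeff_succ, ← mul_assoc b, ih]
      have h1 := hb (l + 1)
      have h2 := hb l
      push_cast at h1 ⊢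
      have h3 : b + 1 + l ≠ 0 := by convert h1 using 1; ring
      field_simp
      ring
  have h5 : a / b * kummerCoeff (a + 1) (b + 1) l - kummerCoeff a b l
      = -((b - a) / b) * kummerCoeff a (b + 1) l := by
    have h6 := h4 l
    have h2 := hb l
    rw [← kummerCoeff_succ', kummerCoeff_succ]
    have h7 : kummerCoeff a b l = (b + l) * kummerCoeff a (b + 1) l / b := by
      rw [← h6]; field_simp
    rw [h7]
    field_simp
    ring
  rw [← mul_assoc (-((b - a) / b)), ← h5]
  ring

/-- Kummer's equation in self-adjoint form, `(z^b e^{-z} F')' = a z^{b-1} e^{-z} F`, for `F = Φ(a,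
b)`, since `F' = (a/b) Φ(a+1, b+1)`. -/
theorem hasDerivAt_rpow_mul_exp_neg_mul_kummerPhi {a b : ℝ} (hb : ∀ n : ℕ, b + n ≠ 0) {z : ℝ}
    (hz : 0 < z) :
    HasDerivAt (fun z => z ^ b * exp (-z) * kummerPhi (a + 1) (b + 1) z)
      (b * (z ^ (b - 1) * exp (-z) * kummerPhi a b z)) z := by
  have h1 := (hasDerivAt_rpow_const (p := b) (Or.inl hz.ne'))
  have h2 : HasDerivAt (fun z : ℝ => exp (-z)) (-exp (-z)) z := by
    simpa using (hasDerivAt_id z).neg.exp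
  refine ((h1.mul h2).mul (hasDerivAt_kummerPhi (a + 1) (b + 1) z)).congr_deriv ?_
  have h3 : z ^ b = z ^ (b - 1) * z := by rw [rpow_sub_one hz.ne']; field_simp
  have h4 := kummerPhi_contiguous_lower (a := a) hb z
  simp only [Pi.mul_apply]
  rw [h3]
  linear_combination (z ^ (b - 1) * exp (-z)) * h4

/-- Together with the next lemma this yields the first-order system for the second solution `z^(1-b)
Φ(1+a-b, 2-b; z)`. -/
theorem hasDerivAt_rpow_mul_kummerPhi {a b : ℝ} (hb : ∀ n : ℕ, b - 1 + n ≠ 0) {z : ℝ} (hz : 0 < z) :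
    HasDerivAt (fun z => z ^ (b - 1) * kummerPhi a b z)
      ((b - 1) * (z ^ (b - 2) * kummerPhi a (b - 1) z)) z := by
  have h1 := (hasDerivAt_rpow_const (p := b - 1) (Or.inl hz.ne'))
  refine (h1.mul (hasDerivAt_kummerPhi a b z)).congr_deriv ?_
  have h3 : z ^ (b - 1) = z ^ (b - 2) * z := by
    rw [← rpow_add_one hz.ne']; congr 1; ring
  have h4 := kummerPhi_contiguous_right (a := a) hb z
  rw [show b - 1 - 1 = b - 2 by ring, h3]
  linear_combination (z ^ (b - 2)) * h4

theorem hasDerivAt_exp_neg_mul_kummerPhi {a b : ℝ} (hb : ∀ n : ℕ, b + n ≠ 0) (z : ℝ) :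
    HasDerivAt (fun z => exp (-z) * kummerPhi a b z)
      (-((b - a) / b) * (exp (-z) * kummerPhi a (b + 1) z)) z := by
  have h2 : HasDerivAt (fun z : ℝ => exp (-z)) (-exp (-z)) z := by
    simpa using (hasDerivAt_id z).neg.exp
  refine (h2.mul (hasDerivAt_kummerPhi a b z)).congr_deriv ?_
  have h4 := kummerPhi_contiguous_upper (a := a) hb z
  linear_combination exp (-z) * h4

/-- Each of the two Kummer terms differentiates into the corresponding term of `Ψ(a+1, b+1)`; the
constants match through `Γ(1-b) = -b Γ(-b)` and `Γ(b) = (b-1) Γ(b-1)`. -/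
theorem hasDerivAt_tricomiPsi {a b : ℝ} (ha : a ≠ 0) (hb : ∀ n : ℤ, b ≠ n) {z : ℝ} (hz : 0 < z) :
    HasDerivAt (tricomiPsi a b) (-a * tricomiPsi (a + 1) (b + 1) z) z := by
  have h0 : b ≠ 0 := by simpa using hb 0
  have h1 : 1 - b ≠ 0 := fun h => hb 1 (by push_cast; linarith)
  have hb' : ∀ n : ℕ, 2 - b - 1 + n ≠ 0 := fun n h => hb (n + 1) (by push_cast; linarith)
  have hd1 := (hasDerivAt_kummerPhi a b z).const_mul (Gamma (1 - b) / Gamma (1 + a - b))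
  have hd2 := (hasDerivAt_rpow_mul_kummerPhi (a := 1 + a - b) hb' hz).const_mul
    (Gamma (b - 1) / Gamma a)
  refine ((hd1.add hd2).congr_deriv ?_).congr_of_eventuallyEq (Filter.Eventually.of_forall fun y => ?_)
  · rw [tricomiPsi, Gamma_add_one ha, show 1 - (b + 1) = -b by ring,
      show 1 + (a + 1) - (b + 1) = 1 + a - b by ring, show 2 - (b + 1) = 1 - b by ring,
      show b + 1 - 1 = b by ring, show 2 - b - 2 = -b by ring, show 2 - b - 1 = 1 - b by ring]
    have e1 : Gamma (1 - b) = -b * Gamma (-b) := by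
      rw [← Gamma_add_one (neg_ne_zero.2 h0)]; ring_nf
    have e2 : Gamma b = (b - 1) * Gamma (b - 1) := by
      rw [← Gamma_add_one (by intro h; apply h1; linarith)]; ring_nf
    rw [e1, e2]
    field_simp
    ring
  · simp only [Pi.add_apply, tricomiPsi]
    rw [show 2 - b - 1 = 1 - b by ring]
    ring

theorem tricomiPsi_zero {a b : ℝ} (hb : b < 1) :
    tricomiPsi a b 0 = Gamma (1 - b) / Gamma (1 + a - b) := by
  rw [tricomiPsi, zero_rpow (by linarith), kummerPhi_zero]
  ring

theorem continuous_tricomiPsi {a b : ℝ} (hb : b < 1) : Continuous (tricomiPsi a b) := by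
  have := continuous_kummerPhi a b
  have := continuous_kummerPhi (1 + a - b) (2 - b)
  have h : Continuous fun z : ℝ => z ^ (1 - b) := continuous_id.rpow_const fun _ => Or.inr (by linarith)
  unfold tricomiPsi
  fun_prop

end Kummer

/-! ### The Beta integral on the half-line -/

section BetaIntegral

open Set Real

theorem image_div_one_add_Ioi : (fun t : ℝ => t / (1 + t)) '' Ioi 0 = Ioo 0 1 := by
  ext x
  simp only [mem_image, mem_Ioi, mem_Ioo]
  constructor
  · rintro ⟨t, ht, rfl⟩
    exact ⟨by positivity, (div_lt_one (by positivity)).2 (by linarith)⟩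
  · rintro ⟨h0, h1⟩
    have : 1 - x ≠ 0 := by linarith
    exact ⟨x / (1 - x), div_pos h0 (by linarith), by field_simp; ring⟩

theorem integrableOn_and_integral_beta {p q : ℝ} (hp : 0 < p) (hq : 0 < q) :
    IntegrableOn (fun x : ℝ => x ^ (p - 1) * (1 - x) ^ (q - 1)) (Ioo 0 1) ∧
    ∫ x in Ioo (0 : ℝ) 1, x ^ (p - 1) * (1 - x) ^ (q - 1) = Gamma p * Gamma q / Gamma (p + q) := by
  have hc := Complex.betaIntegral_convergent (u := p) (v := q) (by simpa) (by simpa)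
  rw [intervalIntegrable_iff_integrableOn_Ioc_of_le (by simp)] at hc
  have heq : EqOn (fun x : ℝ => RCLike.re ((x : ℂ) ^ ((p : ℂ) - 1) * (1 - (x : ℂ)) ^ ((q : ℂ) - 1)))
      (fun x : ℝ => x ^ (p - 1) * (1 - x) ^ (q - 1)) (Ioc 0 1) := by
    rintro x ⟨hx1, hx2⟩
    beta_reduce
    norm_cast
    rw [← Complex.ofReal_cpow, ← Complex.ofReal_cpow, RCLike.re_to_complex,
      Complex.re_mul_ofReal, Complex.ofReal_re]
    all_goals linarith
  constructor
  · exact (IntegrableOn.congr_fun hc.re heq measurableSet_Ioc).mono_set Ioo_subset_Ioc_self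
  · change _ = beta p q
    rw [beta_eq_betaIntegralReal p q hp hq, Complex.betaIntegral,
      intervalIntegral.integral_of_le (by norm_num), ← integral_Ioc_eq_integral_Ioo,
      ← RCLike.re_to_complex, ← integral_re hc]
    exact (setIntegral_congr_fun measurableSet_Ioc heq).symm

theorem integrableOn_and_integral_beta_Ioi {p q : ℝ} (hp : 0 < p) (hq : 0 < q) :
    IntegrableOn (fun t : ℝ => t ^ (p - 1) * (1 + t) ^ (-(p + q))) (Ioi 0) ∧
    ∫ t in Ioi (0 : ℝ), t ^ (p - 1) * (1 + t) ^ (-(p + q)) = Gamma p * Gamma q / Gamma (p + q) := by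
  obtain ⟨h1, h2⟩ := integrableOn_and_integral_beta hp hq
  have hd : ∀ t ∈ Ioi (0 : ℝ), HasDerivWithinAt (fun t : ℝ => t / (1 + t)) (1 / (1 + t) ^ 2) (Ioi 0) t := by
    intro t ht
    have ht : 0 < t := ht
    have h := (hasDerivAt_id t).div ((hasDerivAt_id t).const_add 1) (by simp; positivity)
    refine (h.congr_deriv ?_).hasDerivWithinAt
    simp
  have hinj : InjOn (fun t : ℝ => t / (1 + t)) (Ioi 0) := by
    intro a ha b hb hab
    have ha : 0 < a := ha
    have hb : 0 < b := hb
    simp only at hab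
    rw [div_eq_div_iff (by positivity) (by positivity)] at hab
    linarith
  have heq : EqOn (fun t : ℝ => |1 / (1 + t) ^ 2| •
      ((t / (1 + t)) ^ (p - 1) * (1 - t / (1 + t)) ^ (q - 1)))
      (fun t : ℝ => t ^ (p - 1) * (1 + t) ^ (-(p + q))) (Ioi 0) := by
    intro t ht
    have ht : 0 < t := ht
    have h1t : 0 < 1 + t := by linarith
    beta_reduce
    have e1 : 1 - t / (1 + t) = (1 + t)⁻¹ := by field_simp; ring
    have e2 : (1 + t) ^ (-(p + q)) = ((1 + t) ^ (p - 1))⁻¹ * ((1 + t) ^ (q - 1))⁻¹ * ((1 + t) ^ 2)⁻¹ := by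
      rw [← rpow_neg h1t.le, ← rpow_neg h1t.le, ← rpow_natCast, ← rpow_neg h1t.le, ← rpow_add h1t,
        ← rpow_add h1t]
      congr 1
      push_cast
      ring
    rw [e1, e2, abs_of_pos (by positivity), div_rpow ht.le h1t.le, inv_rpow h1t.le, smul_eq_mul]
    ring
  rw [← image_div_one_add_Ioi, integrableOn_image_iff_integrableOn_abs_deriv_smul measurableSet_Ioi hd hinj] at h1
  rw [← image_div_one_add_Ioi, integral_image_eq_integral_abs_deriv_smul measurableSet_Ioi hd hinj] at h2
  exact ⟨h1.congr_fun heq measurableSet_Ioi, by rw [← h2, setIntegral_congr_fun measurableSet_Ioi heq]⟩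

end BetaIntegral

/-! ### The integral representation: domination, derivatives, behaviour at zero -/

section TricomiIntegral

open Set Real Filter Topology

/-- The integral `∫_0^∞ u ^ (a - b) (u + z) ^ (-a) e ^ (-u) du`, which equals
`Γ(1 + a - b) Ψ(a, b; z)`. -/
noncomputable def tricomiIntegral (a b z : ℝ) : ℝ :=
  ∫ u in Ioi 0, u ^ (a - b) * (u + z) ^ (-a) * exp (-u)

theorem measurable_tricomi_integrand (a b z : ℝ) :
    Measurable fun u : ℝ => u ^ (a - b) * (u + z) ^ (-a) * exp (-u) := by
  fun_prop

/-- A bound uniform in `z ∈ [0, Z]`: for `a ≥ 0` the power is decreasing and the first term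
suffices; for `-1 < a < 0` the power `-a ∈ (0, 1)` is subadditive. -/
theorem add_rpow_neg_le {a u z Z : ℝ} (ha : -1 < a) (hu : 0 < u) (hz : 0 ≤ z) (hzZ : z ≤ Z) :
    (u + z) ^ (-a) ≤ u ^ (-a) + Z ^ (-a) := by
  have hZ : 0 ≤ Z := hz.trans hzZ
  rcases le_or_gt 0 a with h | h
  · have h1 : (u + z) ^ (-a) ≤ u ^ (-a) :=
      rpow_le_rpow_of_nonpos hu (by linarith) (by linarith)
    have h2 : 0 ≤ Z ^ (-a) := rpow_nonneg hZ _
    linarith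
  · calc (u + z) ^ (-a) ≤ (u + Z) ^ (-a) := by
          apply rpow_le_rpow (by linarith) (by linarith) (by linarith)
      _ ≤ _ := rpow_add_le_add_rpow hu.le hZ (by linarith) (by linarith)

theorem integrableOn_tricomi_bound {a b : ℝ} (hab : -1 < a - b) (hb : b < 1) (Z : ℝ) :
    IntegrableOn (fun u : ℝ => u ^ (a - b) * (u ^ (-a) + Z ^ (-a)) * exp (-u)) (Ioi 0) := by
  have h1 := GammaIntegral_convergent (s := 1 - b) (by linarith)
  have h2 := (GammaIntegral_convergent (s := 1 + (a - b)) (by linarith)).mul_const (Z ^ (-a))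
  refine IntegrableOn.congr_fun (h1.add h2) (fun u hu => ?_) measurableSet_Ioi
  have hu : 0 < u := hu
  simp only [Pi.add_apply]
  rw [show 1 - b - 1 = (a - b) + (-a) by ring, rpow_add hu, show 1 + (a - b) - 1 = a - b by ring]
  ring

theorem integrableOn_tricomi {a b : ℝ} (ha : -1 < a) (hab : -1 < a - b) (hb : b < 1) {z : ℝ}
    (hz : 0 ≤ z) :
    IntegrableOn (fun u : ℝ => u ^ (a - b) * (u + z) ^ (-a) * exp (-u)) (Ioi 0) := by
  refine Integrable.mono' (integrableOn_tricomi_bound hab hb z)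
    (measurable_tricomi_integrand a b z).aestronglyMeasurable ?_
  refine ae_restrict_of_forall_mem measurableSet_Ioi fun u hu => ?_
  have hu : 0 < u := hu
  rw [Real.norm_of_nonneg (by positivity)]
  gcongr
  exact add_rpow_neg_le ha hu hz le_rfl

theorem integrableOn_tricomi_of_pos {a b : ℝ} (ha : -1 < a) (hab : -1 < a - b) {z : ℝ} (hz : 0 < z) :
    IntegrableOn (fun u : ℝ => u ^ (a - b) * (u + z) ^ (-a - 1) * exp (-u)) (Ioi 0) := by
  refine Integrable.mono' ((GammaIntegral_convergent (s := 1 + (a - b)) (by linarith)).mul_const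
    (z ^ (-a - 1))) (by fun_prop) ?_
  refine ae_restrict_of_forall_mem measurableSet_Ioi fun u hu => ?_
  have hu : 0 < u := hu
  rw [Real.norm_of_nonneg (by positivity), show 1 + (a - b) - 1 = a - b by ring]
  have : (u + z) ^ (-a - 1) ≤ z ^ (-a - 1) :=
    rpow_le_rpow_of_nonpos hz (by linarith) (by linarith)
  calc u ^ (a - b) * (u + z) ^ (-a - 1) * exp (-u) ≤ u ^ (a - b) * z ^ (-a - 1) * exp (-u) := by gcongr
    _ = _ := by ring

theorem tricomiIntegral_zero {a b : ℝ} (hb : b < 1) : tricomiIntegral a b 0 = Gamma (1 - b) := by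
  rw [tricomiIntegral, Gamma_eq_integral (by linarith)]
  refine setIntegral_congr_fun measurableSet_Ioi fun u hu => ?_
  have hu : 0 < u := hu
  rw [add_zero, ← rpow_add hu, show a - b + -a = 1 - b - 1 by ring]
  ring

theorem tendsto_tricomiIntegral {a b : ℝ} (ha : -1 < a) (hab : -1 < a - b) (hb : b < 1) :
    Tendsto (tricomiIntegral a b) (𝓝[>] 0) (𝓝 (Gamma (1 - b))) := by
  rw [← tricomiIntegral_zero (a := a) hb]
  refine tendsto_integral_filter_of_dominated_convergence
    (fun u : ℝ => u ^ (a - b) * (u ^ (-a) + 1 ^ (-a)) * exp (-u))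
    (Eventually.of_forall fun z => (measurable_tricomi_integrand a b z).aestronglyMeasurable)
    ?_ (integrableOn_tricomi_bound hab hb 1) ?_
  · filter_upwards [self_mem_nhdsWithin, mem_nhdsWithin_of_mem_nhds (gt_mem_nhds one_pos)] with z hz hz1
    have hz : 0 < z := hz
    refine ae_restrict_of_forall_mem measurableSet_Ioi fun u hu => ?_
    have hu : 0 < u := hu
    rw [Real.norm_of_nonneg (by positivity)]
    gcongr
    exact add_rpow_neg_le ha hu hz.le hz1.le
  · refine ae_restrict_of_forall_mem measurableSet_Ioi fun u hu => ?_
    have hu : 0 < u := hu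
    have : ContinuousAt (fun z : ℝ => (u + z) ^ (-a)) 0 :=
      (by fun_prop : ContinuousAt (fun z : ℝ => u + z) 0).rpow_const (Or.inl (by simpa using hu.ne'))
    have : ContinuousAt (fun z : ℝ => u ^ (a - b) * (u + z) ^ (-a) * exp (-u)) 0 :=
      (continuousAt_const.mul this).mul continuousAt_const
    exact this.tendsto.mono_left nhdsWithin_le_nhds

theorem hasDerivAt_tricomiIntegral {a b : ℝ} (ha : -1 < a) (hab : -1 < a - b) (hb : b < 1) {z : ℝ}
    (hz : 0 < z) :
    HasDerivAt (tricomiIntegral a b) (-a * tricomiIntegral (a + 1) (b + 1) z) z := by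
  have key := hasDerivAt_integral_of_dominated_loc_of_deriv_le
    (μ := volume.restrict (Ioi (0 : ℝ)))
    (F := fun z u : ℝ => u ^ (a - b) * (u + z) ^ (-a) * exp (-u))
    (F' := fun z u : ℝ => u ^ (a - b) * (-a * (u + z) ^ (-a - 1)) * exp (-u))
    -- Restricting to `y > z/2` keeps `u + y` away from `0`, so the negative power `-a - 1` is
    -- dominated by its value at `z/2`.
    (bound := fun u => |a| * (u ^ (a - b) * (u + z / 2) ^ (-a - 1) * exp (-u)))
    (x₀ := z) (s := Ioi (z / 2)) (Ioi_mem_nhds (by linarith))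
    (Eventually.of_forall fun z => (measurable_tricomi_integrand a b z).aestronglyMeasurable)
    (integrableOn_tricomi ha hab hb hz.le) (Measurable.aestronglyMeasurable (by fun_prop)) ?_
    ((integrableOn_tricomi_of_pos ha hab (half_pos hz)).const_mul _) ?_
  · refine key.2.congr_deriv ?_
    rw [tricomiIntegral, ← integral_const_mul]
    refine integral_congr_ae (Eventually.of_forall fun u => ?_)
    beta_reduce
    rw [show a + 1 - (b + 1) = a - b by ring, show -(a + 1) = -a - 1 by ring]
    ring
  · refine ae_restrict_of_forall_mem measurableSet_Ioi fun u hu y hy => ?_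
    have hu : 0 < u := hu
    have hy : z / 2 < y := hy
    have hy0 : 0 < y := by linarith
    rw [norm_mul, norm_mul, norm_mul, norm_neg, Real.norm_eq_abs a,
      Real.norm_of_nonneg (by positivity : 0 ≤ u ^ (a - b)),
      Real.norm_of_nonneg (by positivity : 0 ≤ (u + y) ^ (-a - 1)),
      Real.norm_of_nonneg (by positivity : 0 ≤ exp (-u))]
    have : (u + y) ^ (-a - 1) ≤ (u + z / 2) ^ (-a - 1) :=
      rpow_le_rpow_of_nonpos (by linarith) (by linarith) (by linarith)
    calc u ^ (a - b) * (|a| * (u + y) ^ (-a - 1)) * exp (-u)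
        ≤ u ^ (a - b) * (|a| * (u + z / 2) ^ (-a - 1)) * exp (-u) := by gcongr
      _ = _ := by ring
  · refine ae_restrict_of_forall_mem measurableSet_Ioi fun u hu y hy => ?_
    have hu : 0 < u := hu
    have hy : z / 2 < y := hy
    have h := (((hasDerivAt_id y).const_add u).rpow_const (p := -a) (Or.inl (by simp; linarith)))
    have h := (h.const_mul (u ^ (a - b))).mul_const (exp (-u))
    refine h.congr_deriv ?_
    simp

/-- The scaled form of `tricomiIntegral`. -/
theorem integral_tricomi_scaled (a b : ℝ) {z : ℝ} (hz : 0 < z) :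
    ∫ t in Ioi 0, t ^ (a - b) * (1 + t) ^ (-a) * exp (-(z * (1 + t)))
      = z ^ (b - 1) * exp (-z) * tricomiIntegral a b z := by
  have h := integral_comp_mul_left_Ioi (fun u => u ^ (a - b) * (u + z) ^ (-a) * exp (-u)) 0 hz
  rw [mul_zero] at h
  have h2 : tricomiIntegral a b z
      = z * ∫ t in Ioi 0, (z * t) ^ (a - b) * (z * t + z) ^ (-a) * exp (-(z * t)) := by
    rw [h, tricomiIntegral, smul_eq_mul]
    field_simp
  rw [h2, ← integral_const_mul, ← integral_const_mul]
  refine setIntegral_congr_fun measurableSet_Ioi fun t ht => ?_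
  have ht : 0 < t := ht
  rw [show z * t + z = z * (1 + t) by ring, mul_rpow hz.le ht.le, mul_rpow hz.le (by positivity),
    show -(z * (1 + t)) = -z + -(z * t) by ring, exp_add]
  have : z ^ (b - 1) * (z * (z ^ (a - b) * z ^ (-a))) = 1 := by
    rw [← mul_assoc, rpow_sub_one hz.ne', div_mul_cancel₀ _ hz.ne', ← rpow_add hz, ← rpow_add hz,
      show b + (a - b + -a) = 0 by ring, rpow_zero]
  linear_combination (-(t ^ (a - b) * (1 + t) ^ (-a) * (exp (-z) * exp (-(z * t))))) * this

theorem integrableOn_tricomi_scaled {a b : ℝ} (ha : -1 < a) (hab : -1 < a - b) (hb : b < 1) {z : ℝ}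
    (hz : 0 < z) :
    IntegrableOn (fun t => t ^ (a - b) * (1 + t) ^ (-a) * exp (-(z * (1 + t)))) (Ioi 0) := by
  have h := integrableOn_tricomi ha hab hb hz.le
  rw [← mul_zero z, ← integrableOn_Ioi_comp_mul_left_iff _ _ hz] at h
  refine IntegrableOn.congr_fun (h.const_mul (z ^ b * exp (-z))) (fun t ht => ?_) measurableSet_Ioi
  have ht : 0 < t := ht
  rw [show z * t + z = z * (1 + t) by ring, mul_rpow hz.le ht.le, mul_rpow hz.le (by positivity),
    show -(z * (1 + t)) = -z + -(z * t) by ring, exp_add]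
  have : z ^ b * (z ^ (a - b) * z ^ (-a)) = 1 := by
    rw [← rpow_add hz, ← rpow_add hz, show b + (a - b + -a) = 0 by ring, rpow_zero]
  linear_combination ((t ^ (a - b) * (1 + t) ^ (-a) * (exp (-z) * exp (-(z * t))))) * this

/-- The scaling `u = z t` leaves `z` only in `exp(-z(1+t))`. Differentiating brings down `-(1+t)`,
which turns the parameters `(a+1, b+1)` into `(a, b)`. With `hasDerivAt_tricomiIntegral` this is
Kummer's equation for the integral. -/
theorem hasDerivAt_tricomi_scaled {a b : ℝ} (ha : -1 < a) (hab : -1 < a - b) (hb : b < 1) {z : ℝ}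
    (hz : 0 < z) :
    HasDerivAt (fun z => z ^ b * exp (-z) * tricomiIntegral (a + 1) (b + 1) z)
      (-(z ^ (b - 1) * exp (-z) * tricomiIntegral a b z)) z := by
  have hF : ∀ z t : ℝ, 0 < t → t ^ (a + 1 - (b + 1)) * (1 + t) ^ (-(a + 1)) * exp (-(z * (1 + t))) =
      t ^ (a - b) * (1 + t) ^ (-a) * exp (-(z * (1 + t))) * (1 + t)⁻¹ := by
    intro z t ht
    rw [show a + 1 - (b + 1) = a - b by ring, show -(a + 1) = -a - 1 by ring,
      rpow_sub_one (by positivity)]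
    field_simp
  have hmeas : ∀ z : ℝ, AEStronglyMeasurable
      (fun t : ℝ => t ^ (a + 1 - (b + 1)) * (1 + t) ^ (-(a + 1)) * exp (-(z * (1 + t))))
      (volume.restrict (Ioi 0)) := fun z => Measurable.aestronglyMeasurable (by fun_prop)
  have key := hasDerivAt_integral_of_dominated_loc_of_deriv_le
    (μ := volume.restrict (Ioi (0 : ℝ)))
    (F := fun z t : ℝ => t ^ (a + 1 - (b + 1)) * (1 + t) ^ (-(a + 1)) * exp (-(z * (1 + t))))
    (F' := fun z t : ℝ => -(t ^ (a - b) * (1 + t) ^ (-a) * exp (-(z * (1 + t)))))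
    (bound := fun t => t ^ (a - b) * (1 + t) ^ (-a) * exp (-(z / 2 * (1 + t))))
    (x₀ := z) (s := Ioi (z / 2)) (Ioi_mem_nhds (by linarith))
    (Eventually.of_forall hmeas) ?_ (Measurable.aestronglyMeasurable (by fun_prop)) ?_
    (integrableOn_tricomi_scaled ha hab hb (half_pos hz)) ?_
  · have h := key.2
    rw [integral_neg, integral_tricomi_scaled a b hz] at h
    refine h.congr_of_eventuallyEq ?_
    filter_upwards [lt_mem_nhds hz] with y hy
    rw [integral_tricomi_scaled _ _ hy, show b + 1 - 1 = b by ring]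
  · refine Integrable.mono' (integrableOn_tricomi_scaled ha hab hb hz) (hmeas z) ?_
    refine ae_restrict_of_forall_mem measurableSet_Ioi fun t ht => ?_
    have ht : 0 < t := ht
    rw [hF z t ht, Real.norm_of_nonneg (by positivity)]
    exact mul_le_of_le_one_right (by positivity) (inv_le_one_of_one_le₀ (by linarith))
  · refine ae_restrict_of_forall_mem measurableSet_Ioi fun t ht y hy => ?_
    have ht : 0 < t := ht
    have hy : z / 2 < y := hy
    rw [norm_neg, Real.norm_of_nonneg (by positivity)]
    gcongr
  · refine ae_restrict_of_forall_mem measurableSet_Ioi fun t ht y hy => ?_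
    have ht : 0 < t := ht
    have h := ((((hasDerivAt_id y).mul_const (1 + t)).neg.exp).const_mul
      (t ^ (a + 1 - (b + 1)) * (1 + t) ^ (-(a + 1))))
    refine h.congr_deriv ?_
    have := hF y t ht
    simp only [id, Pi.neg_apply]
    have h1 : (1 + t)⁻¹ * (1 + t) = 1 := inv_mul_cancel₀ (by positivity)
    linear_combination (-(1 + t)) * this
      - t ^ (a - b) * (1 + t) ^ (-a) * exp (-(y * (1 + t))) * h1

/-- As `z → 0` the exponential in the scaled integral increases to `1`, so dominated convergence
leaves a Beta integral, finite because `b > 0`. -/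
theorem tendsto_tricomi_scaled {a b : ℝ} (hb : 0 < b) (hab : -1 < a - b) :
    Tendsto (fun z => z ^ b * exp (-z) * tricomiIntegral (a + 1) (b + 1) z) (𝓝[>] 0)
      (𝓝 (Gamma (1 + a - b) * Gamma b / Gamma (a + 1))) := by
  obtain ⟨h1, h2⟩ := integrableOn_and_integral_beta_Ioi (p := 1 + a - b) (q := b) (by linarith) hb
  rw [show 1 + a - b + b = a + 1 by ring] at h1 h2
  rw [← h2]
  have h3 : Tendsto (fun z : ℝ => ∫ t in Ioi (0 : ℝ),
      t ^ (1 + a - b - 1) * (1 + t) ^ (-(a + 1)) * exp (-(z * (1 + t)))) (𝓝[>] 0)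
      (𝓝 (∫ t in Ioi (0 : ℝ), t ^ (1 + a - b - 1) * (1 + t) ^ (-(a + 1)))) := by
    refine tendsto_integral_filter_of_dominated_convergence _
      (Eventually.of_forall fun z => Measurable.aestronglyMeasurable (by fun_prop)) ?_ h1 ?_
    · filter_upwards [self_mem_nhdsWithin] with z hz
      have hz : 0 < z := hz
      refine ae_restrict_of_forall_mem measurableSet_Ioi fun t ht => ?_
      have ht : 0 < t := ht
      rw [Real.norm_of_nonneg (by positivity)]
      refine mul_le_of_le_one_right (by positivity) (exp_le_one_iff.2 ?_)
      have : 0 < z * (1 + t) := by positivity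
      linarith
    · refine ae_restrict_of_forall_mem measurableSet_Ioi fun t ht => ?_
      have : Continuous fun z : ℝ => t ^ (1 + a - b - 1) * (1 + t) ^ (-(a + 1)) * exp (-(z * (1 + t))) := by
        fun_prop
      have := (this.tendsto 0).mono_left (nhdsWithin_le_nhds (s := Ioi 0))
      simpa using this
  refine h3.congr' ?_
  filter_upwards [self_mem_nhdsWithin] with z hz
  have := integral_tricomi_scaled (a + 1) (b + 1) hz
  rw [show b + 1 - 1 = b by ring] at this
  rw [← this, show a + 1 - (b + 1) = 1 + a - b - 1 by ring]

end TricomiIntegral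

/-! ### Identification of the integral with `Ψ` -/

section Connection

open Set Real Filter Topology

theorem eq_of_hasDerivAt_zero_Ioi {f : ℝ → ℝ} {l : ℝ} (hf : ∀ z, 0 < z → HasDerivAt f 0 z)
    (hl : Tendsto f (𝓝[>] 0) (𝓝 l)) {z : ℝ} (hz : 0 < z) : f z = l := by
  have hc : ∀ y, 0 < y → f y = f z := fun y hy =>
    isOpen_Ioi.is_const_of_deriv_eq_zero isPreconnected_Ioi
      (fun x hx => (hf x hx).differentiableAt.differentiableWithinAt)
      (fun x hx => (hf x hx).deriv) hy hz
  refine tendsto_nhds_unique ?_ hl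
  refine tendsto_const_nhds.congr' ?_
  filter_upwards [self_mem_nhdsWithin] with y hy
  exact (hc y hy).symm

/-- Uniqueness for Kummer's equation, written as a system for `F` and `P = z ^ b e ^ (-z) F'`:
a solution vanishing at `0` together with `P` is zero, provided that a positive solution `y`
vanishing at `0` exists whose quasi-derivative `q` does not vanish at `0`. -/
theorem eq_zero_of_kummer_system {a b l : ℝ} {F P y q : ℝ → ℝ} (hl : l ≠ 0)
    (hF : ∀ z, 0 < z → HasDerivAt F (z ^ (-b) * exp z * P z) z)
    (hP : ∀ z, 0 < z → HasDerivAt P (a * (z ^ (b - 1) * exp (-z) * F z)) z)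
    (hy : ∀ z, 0 < z → HasDerivAt y (z ^ (-b) * exp z * q z) z)
    (hq : ∀ z, 0 < z → HasDerivAt q (a * (z ^ (b - 1) * exp (-z) * y z)) z)
    (hpos : ∀ z, 0 < z → 0 < y z)
    (hF0 : Tendsto F (𝓝[>] 0) (𝓝 0)) (hP0 : Tendsto P (𝓝[>] 0) (𝓝 0))
    (hy0 : Tendsto y (𝓝[>] 0) (𝓝 0)) (hq0 : Tendsto q (𝓝[>] 0) (𝓝 l)) {z : ℝ} (hz : 0 < z) :
    F z = 0 := by
  -- The Wronskian is constant, as the cross terms in its derivative cancel, and tends to `0` at the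
  -- origin.
  have hW : ∀ z, 0 < z → P z * y z - F z * q z = 0 := fun z hz => by
    refine eq_of_hasDerivAt_zero_Ioi (f := fun z => P z * y z - F z * q z) (fun z hz => ?_) ?_ hz
    · refine (((hP z hz).mul (hy z hz)).sub ((hF z hz).mul (hq z hz))).congr_deriv ?_
      ring
    · simpa using (hP0.mul hy0).sub (hF0.mul hq0)
  -- The derivative of `F / y` is a multiple of the Wronskian, so `F = c y` and `P = c q`. Letting
  -- `x → 0` gives `c l = 0`, hence `c = 0`.
  have hratio : ∀ x, 0 < x → F x = F z / y z * y x := fun x hx => by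
    have h : F x / y x = F z / y z :=
      isOpen_Ioi.is_const_of_deriv_eq_zero (f := fun x => F x / y x) isPreconnected_Ioi
        (fun x hx => ((hF x hx).div (hy x hx) (hpos x hx).ne').differentiableAt.differentiableWithinAt)
        (fun x hx => by
          rw [((hF x hx).fun_div (hy x hx) (hpos x hx).ne').deriv]
          have h0 := hW x hx
          refine div_eq_zero_iff.2 (Or.inl ?_)
          linear_combination (x ^ (-b) * exp x) * h0) hx hz
    have := (hpos x hx).ne'
    rw [← h]
    field_simp
  have hPq : ∀ x, 0 < x → P x = F z / y z * q x := fun x hx => by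
    have h0 := hW x hx
    rw [hratio x hx] at h0
    apply mul_right_cancel₀ (hpos x hx).ne'
    linear_combination h0
  have hlim : Tendsto P (𝓝[>] 0) (𝓝 (F z / y z * l)) := by
    refine (hq0.const_mul _).congr' ?_
    filter_upwards [self_mem_nhdsWithin] with x hx
    exact (hPq x hx).symm
  have := tendsto_nhds_unique hlim hP0
  rw [hratio z hz, (mul_eq_zero.1 this).resolve_right hl, zero_mul]

/-- The difference of the two sides and its quasi-derivative both vanish at `0`, so
`eq_zero_of_kummer_system` applies with the second Kummer solution as comparison function, positive
on `(0, ∞)`. -/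
theorem tricomiIntegral_eq_of_pos {a b : ℝ} (ha : 0 < a) (hb0 : 0 < b) (hb1 : b < 1)
    (hab : -1 < a - b) {z : ℝ} (hz : 0 ≤ z) :
    tricomiIntegral a b z = Gamma (1 + a - b) * tricomiPsi a b z := by
  have hκ : Gamma (1 + a - b) ≠ 0 := (Gamma_pos_of_pos (by linarith)).ne'
  rcases hz.eq_or_lt with rfl | hz
  · rw [tricomiIntegral_zero hb1, tricomiPsi_zero hb1]
    field_simp
  have hΓa : Gamma a ≠ 0 := (Gamma_pos_of_pos ha).ne'
  have hb1' : 1 - b ≠ 0 := by linarith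
  have hbn : ∀ n : ℕ, b + n ≠ 0 := fun n => by positivity
  have hbn' : ∀ n : ℕ, 1 - b + n ≠ 0 := fun n => by
    have : (0 : ℝ) ≤ n := n.cast_nonneg
    linarith
  have hbn2 : ∀ n : ℕ, 2 - b - 1 + n ≠ 0 := fun n => by
    have := hbn' n
    rwa [show 2 - b - 1 = 1 - b by ring]
  have hexp : ∀ z : ℝ, exp z * exp (-z) = 1 := fun z => by rw [← exp_add]; simp
  have hrp : ∀ z : ℝ, 0 < z → z ^ (-b) * z ^ b = 1 := fun z hz => by rw [← rpow_add hz]; simp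
  set κ := Gamma (1 + a - b)
  set y : ℝ → ℝ := fun z => z ^ (1 - b) * kummerPhi (1 + a - b) (2 - b) z
  set q : ℝ → ℝ := fun z => (1 - b) * (exp (-z) * kummerPhi (1 + a - b) (1 - b) z)
  have hy : ∀ z, 0 < z → HasDerivAt y (z ^ (-b) * exp z * q z) z := fun z hz => by
    have h := hasDerivAt_rpow_mul_kummerPhi (a := 1 + a - b) hbn2 hz
    rw [show 2 - b - 1 = 1 - b by ring, show 2 - b - 2 = -b by ring] at h
    refine h.congr_deriv ?_
    simp only [q]
    linear_combination (-(1 - b) * (z ^ (-b) * kummerPhi (1 + a - b) (1 - b) z)) * hexp z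
  have hq : ∀ z, 0 < z → HasDerivAt q (a * (z ^ (b - 1) * exp (-z) * y z)) z := fun z hz => by
    refine ((hasDerivAt_exp_neg_mul_kummerPhi (a := 1 + a - b) hbn' z).const_mul (1 - b)).congr_deriv ?_
    have h : z ^ (b - 1) * z ^ (1 - b) = 1 := by rw [← rpow_add hz]; simp
    simp only [y]
    rw [show 1 - b - (1 + a - b) = -a by ring, show 1 - b + 1 = 2 - b by ring]
    field_simp
    linear_combination (-(kummerPhi (1 + a - b) (2 - b) z)) * h
  have hy0 : Tendsto y (𝓝[>] 0) (𝓝 0) := by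
    have hc : Continuous y := (continuous_id.rpow_const fun _ => Or.inr (by linarith)).mul
      (continuous_kummerPhi _ _)
    have := hc.tendsto 0
    simp only [y, zero_rpow hb1', zero_mul] at this
    exact this.mono_left nhdsWithin_le_nhds
  have hq0 : Tendsto q (𝓝[>] 0) (𝓝 (1 - b)) := by
    have := continuous_kummerPhi (1 + a - b) (1 - b)
    have hc : Continuous q := by fun_prop
    have := hc.tendsto 0
    simp only [q, kummerPhi_zero, neg_zero, exp_zero, mul_one] at this
    exact this.mono_left nhdsWithin_le_nhds
  have hpos : ∀ z, 0 < z → 0 < y z := fun z hz =>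
    mul_pos (rpow_pos_of_pos hz _) (kummerPhi_pos (by linarith) (by linarith) hz.le)
  set c₂ : ℝ := κ * (Gamma (b - 1) / Gamma a)
  have hΨ : ∀ z, κ * tricomiPsi a b z = Gamma (1 - b) * kummerPhi a b z + c₂ * y z := fun z => by
    rw [tricomiPsi, show Gamma (1 + a - b) = κ from rfl]
    simp only [c₂, y]
    field_simp
  have key := eq_zero_of_kummer_system (a := a) (b := b) (l := 1 - b)
    (F := fun z => tricomiIntegral a b z - (Gamma (1 - b) * kummerPhi a b z + c₂ * y z))
    (P := fun z => -a * (z ^ b * exp (-z) * tricomiIntegral (a + 1) (b + 1) z)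
      - (Gamma (1 - b) * (a / b * (z ^ b * exp (-z) * kummerPhi (a + 1) (b + 1) z)) + c₂ * q z))
    hb1' ?_ ?_ hy hq hpos ?_ ?_ hy0 hq0 hz
  · rw [hΨ]
    linarith
  · intro z hz
    refine ((hasDerivAt_tricomiIntegral (by linarith) hab hb1 hz).sub
      (((hasDerivAt_kummerPhi a b z).const_mul _).add ((hy z hz).const_mul c₂))).congr_deriv ?_
    have h : z ^ (-b) * exp z * (z ^ b * exp (-z)) = 1 := by
      linear_combination (exp z * exp (-z)) * hrp z hz + hexp z
    linear_combination (a * tricomiIntegral (a + 1) (b + 1) z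
      + Gamma (1 - b) * (a / b * kummerPhi (a + 1) (b + 1) z)) * h
  · intro z hz
    refine (((hasDerivAt_tricomi_scaled (by linarith) hab hb1 hz).const_mul (-a)).sub
      ((((hasDerivAt_rpow_mul_exp_neg_mul_kummerPhi (a := a) hbn hz).const_mul (a / b)).const_mul _).add
        ((hq z hz).const_mul c₂))).congr_deriv ?_
    field_simp
  · have h2 := (continuous_kummerPhi a b).tendsto 0
    rw [kummerPhi_zero] at h2
    have := (tendsto_tricomiIntegral (by linarith) hab hb1).sub
      (((h2.mono_left nhdsWithin_le_nhds).const_mul (Gamma (1 - b))).add (hy0.const_mul c₂))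
    simpa using this
  · have h1 := (tendsto_tricomi_scaled hb0 hab).const_mul (-a)
    have h2 : Tendsto (fun z => z ^ b * exp (-z) * kummerPhi (a + 1) (b + 1) z) (𝓝[>] 0) (𝓝 0) := by
      have := continuous_kummerPhi (a + 1) (b + 1)
      have h : Continuous fun z : ℝ => z ^ b := continuous_id.rpow_const fun _ => Or.inr hb0.le
      have hc : Continuous fun z => z ^ b * exp (-z) * kummerPhi (a + 1) (b + 1) z := by fun_prop
      have := hc.tendsto 0
      simp only [zero_rpow hb0.ne', zero_mul] at this
      exact this.mono_left nhdsWithin_le_nhds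
    -- The limit of the quasi-derivative is `-Γ(1+a-b) Γ(b) / Γ(a) - c₂ (1-b)`. It vanishes by `Γ(b)
    -- = (b-1) Γ(b-1)`, which is what fixes the second coefficient of `Ψ`.
    have h3 := h1.sub (((h2.const_mul (a / b)).const_mul (Gamma (1 - b))).add (hq0.const_mul c₂))
    refine h3.trans_eq ?_
    congr 1
    have e2 : Gamma b = (b - 1) * Gamma (b - 1) := by
      rw [← Gamma_add_one (by intro h; apply hb1'; linarith)]; ring_nf
    rw [Gamma_add_one ha.ne', e2]
    simp only [c₂]
    field_simp
    ring

/-- Both sides have derivative `-a` times their analogue at `(a+1, b+1)`, with the same `1 + a - b`.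
Those parameters fall under the positive case, and the values at `0` agree. -/
theorem tricomiIntegral_eq_of_neg {a b : ℝ} (ha : -1 < a) (ha0 : a < 0) (hb : -1 < b) (hb0 : b < 0)
    (hab : -1 < a - b) {z : ℝ} (hz : 0 ≤ z) :
    tricomiIntegral a b z = Gamma (1 + a - b) * tricomiPsi a b z := by
  have hκ : Gamma (1 + a - b) ≠ 0 := (Gamma_pos_of_pos (by linarith)).ne'
  have h0 : Gamma (1 + a - b) * tricomiPsi a b 0 = Gamma (1 - b) := by
    rw [tricomiPsi_zero (by linarith)]
    field_simp
  rcases hz.eq_or_lt with rfl | hz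
  · rw [tricomiIntegral_zero (by linarith), h0]
  have hbn : ∀ n : ℤ, b ≠ n := by
    rintro n rfl
    have h1 : (-1 : ℤ) < n := by exact_mod_cast hb
    have h2 : n < (0 : ℤ) := by exact_mod_cast hb0
    omega
  rw [← sub_eq_zero]
  refine eq_of_hasDerivAt_zero_Ioi
    (f := fun z => tricomiIntegral a b z - Gamma (1 + a - b) * tricomiPsi a b z) (fun z hz => ?_) ?_ hz
  · refine ((hasDerivAt_tricomiIntegral ha hab (by linarith) hz).sub
      ((hasDerivAt_tricomiPsi ha0.ne hbn hz).const_mul _)).congr_deriv ?_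
    rw [tricomiIntegral_eq_of_pos (by linarith) (by linarith) (by linarith) (by linarith) hz.le,
      show 1 + (a + 1) - (b + 1) = 1 + a - b by ring]
    ring
  · have h1 := ((continuous_tricomiPsi (a := a) (b := b) (by linarith)).tendsto 0).mono_left
      (nhdsWithin_le_nhds (s := Ioi 0))
    have := (tendsto_tricomiIntegral ha hab (by linarith)).sub (h1.const_mul (Gamma (1 + a - b)))
    rwa [h0, sub_self] at this

/-! ### The correlation function: its `Ψ` form and its increments -/

theorem Cconst_eq {α : ℝ} (hα : 0 < α) : Cconst α = Gamma ((α + 1) / 2) / Gamma α := by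
  -- Legendre's duplication formula.
  have h := Gamma_mul_Gamma_add_half (α / 2)
  have h1 : Gamma (α / 2) ≠ 0 := (Gamma_pos_of_pos (by linarith)).ne'
  have h2 : Gamma α ≠ 0 := (Gamma_pos_of_pos hα).ne'
  rw [show α / 2 + 1 / 2 = (α + 1) / 2 by ring, show 2 * (α / 2) = α by ring] at h
  rw [Cconst, div_eq_div_iff h1 h2]
  linear_combination -h

/-- The correlation function of the Hadamard fractional Brownian motion in logarithmic scale. -/
noncomputable def logCorrelation (α L : ℝ) : ℝ :=
  1 / Gamma α * ∫ r in Ioi 0, r ^ ((α - 1) / 2) * (r + L) ^ ((α - 1) / 2) * exp (-r)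

theorem logCorrelation_eq_tricomiIntegral (α L : ℝ) :
    logCorrelation α L = 1 / Gamma α * tricomiIntegral ((1 - α) / 2) (1 - α) L := by
  rw [logCorrelation, tricomiIntegral]
  rw [show (1 - α) / 2 - (1 - α) = (α - 1) / 2 by ring, show -((1 - α) / 2) = (α - 1) / 2 by ring]

theorem logCorrelation_eq_tricomiPsi {α : ℝ} (hα₀ : 0 < α) (hα₂ : α < 2) (hα : α ≠ 1) {L : ℝ}
    (hL : 0 ≤ L) : logCorrelation α L = Cconst α * tricomiPsi ((1 - α) / 2) (1 - α) L := by
  have h : tricomiIntegral ((1 - α) / 2) (1 - α) L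
      = Gamma (1 + (1 - α) / 2 - (1 - α)) * tricomiPsi ((1 - α) / 2) (1 - α) L := by
    rcases lt_or_gt_of_ne hα with h | h
    · exact tricomiIntegral_eq_of_pos (by linarith) (by linarith) (by linarith) (by linarith) hL
    · exact tricomiIntegral_eq_of_neg (by linarith) (by linarith) (by linarith) (by linarith)
        (by linarith) hL
  rw [logCorrelation_eq_tricomiIntegral, h, Cconst_eq hα₀,
    show 1 + (1 - α) / 2 - (1 - α) = (α + 1) / 2 by ring]
  ring

theorem logCorrelation_zero {α : ℝ} (hα₀ : 0 < α) : logCorrelation α 0 = 1 := by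
  rw [logCorrelation_eq_tricomiIntegral, tricomiIntegral_zero (by linarith),
    show 1 - (1 - α) = α by ring]
  exact one_div_mul_cancel (Gamma_pos_of_pos hα₀).ne'

theorem integrableOn_logCorrelation {α : ℝ} (hα₀ : 0 < α) (hα₂ : α < 2) {L : ℝ} (hL : 0 ≤ L) :
    IntegrableOn (fun r => r ^ ((α - 1) / 2) * (r + L) ^ ((α - 1) / 2) * exp (-r)) (Ioi 0) := by
  have h := integrableOn_tricomi (a := (1 - α) / 2) (b := 1 - α) (by linarith) (by linarith)
    (by linarith) hL
  rwa [show (1 - α) / 2 - (1 - α) = (α - 1) / 2 by ring, show -((1 - α) / 2) = (α - 1) / 2 by ring] at h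

/-- The difference quotient `((m + L) ^ β - m ^ β) / β` is decreasing in `m`, for `β < 1`. -/
theorem rpow_sub_div_antitone {β m m' L : ℝ} (hβ : β < 1) (hβ0 : β ≠ 0) (hm : 0 < m) (hmm : m ≤ m')
    (hL : 0 ≤ L) :
    ((m' + L) ^ β - m' ^ β) / β ≤ ((m + L) ^ β - m ^ β) / β := by
  have hanti : AntitoneOn (fun m : ℝ => ((m + L) ^ β - m ^ β) / β) (Ioi 0) := by
    have hd : ∀ x ∈ Ioi (0 : ℝ), HasDerivAt (fun m : ℝ => ((m + L) ^ β - m ^ β) / β)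
        ((x + L) ^ (β - 1) - x ^ (β - 1)) x := fun x hx => by
      have hx : 0 < x := hx
      have h1 := ((hasDerivAt_id x).add_const L).rpow_const (p := β) (Or.inl (by simp; linarith))
      have h2 := hasDerivAt_rpow_const (p := β) (Or.inl hx.ne')
      refine ((h1.sub h2).div_const β).congr_deriv ?_
      simp
      field_simp
    refine antitoneOn_of_deriv_nonpos (convex_Ioi 0)
      (fun x hx => (hd x hx).continuousAt.continuousWithinAt)
      (fun x hx => ?_) fun x hx => ?_
    all_goals rw [interior_Ioi] at hx
    · exact (hd x hx).differentiableAt.differentiableWithinAt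
    · rw [(hd x hx).deriv]
      have hx : 0 < x := hx
      have := rpow_le_rpow_of_nonpos (z := β - 1) hx (by linarith : x ≤ x + L) (by linarith)
      linarith
  exact hanti hm (hm.trans_le hmm) hmm

theorem rpow_sub_div_pos {β m L : ℝ} (hβ0 : β ≠ 0) (hm : 0 < m) (hL : 0 < L) :
    0 < ((m + L) ^ β - m ^ β) / β := by
  rcases lt_or_gt_of_ne hβ0 with h | h
  · refine div_pos_of_neg_of_neg ?_ h
    have := rpow_lt_rpow_of_neg hm (by linarith : m < m + L) h
    linarith
  · refine div_pos ?_ h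
    have := rpow_lt_rpow hm.le (by linarith : m < m + L) h
    linarith

/-- Dividing by `(α-1)/2` inside the integral makes the integrand positive for `L > 0` whether `α <
1` or `α > 1`; the sign is carried by the prefactor. -/
theorem logCorrelation_sub {α : ℝ} (hα₀ : 0 < α) (hα₂ : α < 2) (hα : α ≠ 1) {m L : ℝ}
    (hm : 0 ≤ m) (hL : 0 ≤ L) :
    IntegrableOn (fun r => r ^ ((α - 1) / 2) * exp (-r) *
      (((r + m + L) ^ ((α - 1) / 2) - (r + m) ^ ((α - 1) / 2)) / ((α - 1) / 2))) (Ioi 0) ∧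
    logCorrelation α (m + L) - logCorrelation α m
      = (α - 1) / 2 * (1 / Gamma α) * ∫ r in Ioi 0, r ^ ((α - 1) / 2) * exp (-r) *
        (((r + m + L) ^ ((α - 1) / 2) - (r + m) ^ ((α - 1) / 2)) / ((α - 1) / 2)) := by
  have hα' : α - 1 ≠ 0 := sub_ne_zero.2 hα
  have h1 := integrableOn_logCorrelation hα₀ hα₂ (add_nonneg hm hL)
  have h2 := integrableOn_logCorrelation hα₀ hα₂ hm
  have heq : (fun r => r ^ ((α - 1) / 2) * exp (-r) *
      (((r + m + L) ^ ((α - 1) / 2) - (r + m) ^ ((α - 1) / 2)) / ((α - 1) / 2)))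
      = fun r => ((α - 1) / 2)⁻¹ * (r ^ ((α - 1) / 2) * (r + (m + L)) ^ ((α - 1) / 2) * exp (-r)
        - r ^ ((α - 1) / 2) * (r + m) ^ ((α - 1) / 2) * exp (-r)) := by
    funext r
    rw [add_assoc r m L]
    ring
  rw [heq]
  refine ⟨(h1.sub h2).const_mul _, ?_⟩
  rw [integral_const_mul, integral_sub h1 h2, logCorrelation, logCorrelation]
  field_simp

/-- The sign of the covariance of disjoint increments. -/
theorem sign_mul_covariance_pos {α : ℝ} (hα₀ : 0 < α) (hα₂ : α < 2) (hα : α ≠ 1) {u v L m m' : ℝ}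
    (hu : 0 ≤ u) (huv : u < v) (hL : 0 < L) (hm : 0 ≤ m) (hm' : u ≠ 0 → m ≤ m') :
    0 < (α - 1) / 2 * (v * (logCorrelation α (m + L) - logCorrelation α m)
      - u * (logCorrelation α (m' + L) - logCorrelation α m')) := by
  set β := (α - 1) / 2 with hβ
  have hβ0 : β ≠ 0 := fun h => hα (by linarith)
  have hΓ : 0 < 1 / Gamma α := one_div_pos.2 (Gamma_pos_of_pos hα₀)
  set I : ℝ → ℝ := fun m => ∫ r in Ioi 0, r ^ β * exp (-r) * (((r + m + L) ^ β - (r + m) ^ β) / β)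
  have hI : ∀ m, 0 ≤ m → IntegrableOn (fun r => r ^ β * exp (-r) * (((r + m + L) ^ β - (r + m) ^ β) / β))
      (Ioi 0) ∧ logCorrelation α (m + L) - logCorrelation α m = β * (1 / Gamma α) * I m := fun m hm =>
    logCorrelation_sub hα₀ hα₂ hα hm hL.le
  have hpos : 0 < I m := by
    have hp : ∀ r ∈ Ioi (0 : ℝ), 0 < r ^ β * exp (-r) * (((r + m + L) ^ β - (r + m) ^ β) / β) :=
      fun r hr => by
        have hr : 0 < r := hr
        have := rpow_sub_div_pos hβ0 (by linarith : 0 < r + m) hL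
        positivity
    refine (setIntegral_pos_iff_support_of_nonneg_ae ?_ (hI m hm).1).2 ?_
    · exact ae_restrict_of_forall_mem measurableSet_Ioi fun r hr => (hp r hr).le
    · have hsub : Ioi 0 ⊆ Function.support fun r =>
          r ^ β * exp (-r) * (((r + m + L) ^ β - (r + m) ^ β) / β) := fun r hr => (hp r hr).ne'
      rw [inter_eq_right.2 hsub, volume_Ioi]
      simp
  have hβ2 : 0 < β * β := mul_self_pos.2 hβ0
  -- For `u = 0` the second term vanishes. This case is separate because `m'` will be `log(s/u)`,
  -- which is `0` by convention at `u = 0`, so that `m ≤ m'` may fail.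
  rcases hu.eq_or_lt with rfl | hu
  · rw [(hI m hm).2]
    have : 0 < β * β * (1 / Gamma α * (v * I m)) := by positivity
    linarith
  · have hmm := hm' hu.ne'
    have hle : I m' ≤ I m := by
      refine setIntegral_mono_on (hI m' (hm.trans hmm)).1 (hI m hm).1 measurableSet_Ioi fun r hr => ?_
      have hr : 0 < r := hr
      have := rpow_sub_div_antitone (by linarith : β < 1) hβ0 (by linarith : 0 < r + m)
        (by linarith : r + m ≤ r + m') hL.le
      gcongr
    rw [(hI m hm).2, (hI m' (hm.trans hmm)).2]
    have h1 : u * I m' < v * I m :=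
      (mul_le_mul_of_nonneg_left hle hu.le).trans_lt (mul_lt_mul_of_pos_right huv hpos)
    have : 0 < β * β * (1 / Gamma α * (v * I m - u * I m')) :=
      mul_pos hβ2 (mul_pos hΓ (by linarith))
    linarith

end Connection

/-! ### Covariance and laws of the process -/

section FractionalBrownianMotion

open Real

/-- The covariance function of the Hadamard fractional Brownian motion. -/
noncomputable def fbmCov (α s t : ℝ) : ℝ :=
  min s t * logCorrelation α (log (max s t / min s t))

theorem fbmCov_comm (α s t : ℝ) : fbmCov α s t = fbmCov α t s := by
  rw [fbmCov, fbmCov, min_comm, max_comm]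

theorem fbmCov_of_le (α : ℝ) {s t : ℝ} (h : s ≤ t) :
    fbmCov α s t = s * logCorrelation α (log (t / s)) := by
  rw [fbmCov, min_eq_left h, max_eq_right h]

theorem fbmCov_zero_left (α : ℝ) {t : ℝ} (ht : 0 ≤ t) : fbmCov α 0 t = 0 := by
  rw [fbmCov_of_le α ht, zero_mul]

theorem fbmCov_self {α : ℝ} (hα₀ : 0 < α) (t : ℝ) : fbmCov α t t = t := by
  rw [fbmCov_of_le α le_rfl]
  rcases eq_or_ne t 0 with rfl | ht
  · simp
  · rw [div_self ht, log_one, logCorrelation_zero hα₀, mul_one]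

/-- The ratio inside the logarithm is scale invariant; this homogeneity is the source of
self-similarity. -/
theorem fbmCov_mul (α : ℝ) {c : ℝ} (hc : 0 < c) (s t : ℝ) :
    fbmCov α (c * s) (c * t) = c * fbmCov α s t := by
  rw [fbmCov, fbmCov, ← mul_min_of_nonneg _ _ hc.le, ← mul_max_of_nonneg _ _ hc.le,
    mul_div_mul_left _ _ hc.ne', mul_assoc]

theorem memLp_hadamardM {α : ℝ} (hα₀ : 0 < α) (t : ℝ) :
    MemLp (hadamardM α ((Set.Ico (0 : ℝ) t).indicator fun _ => 1)) 2 volume :=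
  (memLp_congr_ae (hadamardM_indicator_ae hα₀ t)).2
    ((memLp_logKernel (by linarith) t).const_mul _)

/-- The kernel of the Hadamard fractional Brownian motion at time `t`, as an element of `L²`. -/
noncomputable def fbmKernel {α : ℝ} (hα₀ : 0 < α) (t : ℝ≥0) : Lp ℝ 2 (volume : Measure ℝ) :=
  (memLp_hadamardM hα₀ t).toLp _

theorem inner_fbmKernel {α : ℝ} (hα₀ : 0 < α) (s t : ℝ≥0) :
    inner ℝ (fbmKernel hα₀ s) (fbmKernel hα₀ t) = fbmCov α s t := by
  wlog hst : s ≤ t generalizing s t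
  · rw [real_inner_comm, fbmCov_comm]
    exact this t s (le_of_not_ge hst)
  have hst' : (s : ℝ) ≤ t := hst
  have h : inner ℝ (fbmKernel hα₀ s) (fbmKernel hα₀ t)
      = 1 / Gamma α * ∫ x, logKernel ((α - 1) / 2) s x * logKernel ((α - 1) / 2) t x := by
    rw [L2.inner_def, ← integral_const_mul]
    refine integral_congr_ae ?_
    filter_upwards [(memLp_hadamardM hα₀ s).coeFn_toLp, (memLp_hadamardM hα₀ t).coeFn_toLp,
      hadamardM_indicator_ae hα₀ s, hadamardM_indicator_ae hα₀ t] with x h1 h2 h3 h4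
    rw [fbmKernel, fbmKernel, h1, h2, h3, h4]
    have h5 : 1 / √(Gamma α) * (1 / √(Gamma α)) = 1 / Gamma α := by
      rw [one_div_mul_one_div, mul_self_sqrt (Gamma_pos_of_pos hα₀).le]
    simp only [RCLike.inner_apply, conj_trivial]
    rw [← h5]
    ring
  rw [h, fbmCov_of_le α hst']
  rcases eq_zero_or_pos s with rfl | hs
  · rw [NNReal.coe_zero, logKernel_eq_zero_of_nonpos _ le_rfl]
    simp
  · rw [integral_logKernel_mul _ (by exact_mod_cast hs) hst', logCorrelation]
    ring

variable {ν : Measure TemperedDual} (hν : IsWhiteNoise ν)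

theorem hadamardFBm_eq {α : ℝ} (hα₀ : 0 < α) (t : ℝ≥0) :
    hadamardFBm hν α t = pairingLp hν (fbmKernel hα₀ t) := by
  funext ω
  rw [hadamardFBm, pairing, dif_pos (memLp_hadamardM hα₀ t)]
  rfl

theorem measurable_hadamardFBm {α : ℝ} (hα₀ : 0 < α) (t : ℝ≥0) :
    Measurable (hadamardFBm hν α t) := by
  rw [hadamardFBm_eq hν hα₀]
  exact (Lp.stronglyMeasurable _).measurable

theorem memLp_hadamardFBm {α : ℝ} (hα₀ : 0 < α) (t : ℝ≥0) : MemLp (hadamardFBm hν α t) 2 ν := by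
  rw [hadamardFBm_eq hν hα₀]
  exact Lp.memLp _

theorem covariance_hadamardFBm {α : ℝ} (hα₀ : 0 < α) (s t : ℝ≥0) :
    cov[hadamardFBm hν α s, hadamardFBm hν α t; ν] = fbmCov α s t := by
  rw [hadamardFBm_eq hν hα₀, hadamardFBm_eq hν hα₀, covariance_pairingLp, inner_fbmKernel]

theorem covariance_increments {α : ℝ} (hα₀ : 0 < α) (s t u v : ℝ≥0) :
    cov[fun ω => hadamardFBm hν α t ω - hadamardFBm hν α s ω,
      fun ω => hadamardFBm hν α v ω - hadamardFBm hν α u ω; ν]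
      = fbmCov α t v - fbmCov α t u - fbmCov α s v + fbmCov α s u := by
  have := hν.isProbabilityMeasure
  rw [covariance_fun_sub_fun_sub (memLp_hadamardFBm hν hα₀ t) (memLp_hadamardFBm hν hα₀ s)
    (memLp_hadamardFBm hν hα₀ v) (memLp_hadamardFBm hν hα₀ u)]
  simp only [covariance_hadamardFBm hν hα₀]

/-- The characteristic function of the finite-dimensional distributions. -/
theorem integral_exp_sum_hadamardFBm {α : ℝ} (hα₀ : 0 < α) {ι : Type*} [Fintype ι] (k : ι → ℝ)
    (τ : ι → ℝ≥0) :
    ∫ ω, Complex.exp (Complex.I * ((∑ i, k i * hadamardFBm hν α (τ i) ω : ℝ) : ℂ)) ∂ν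
      = Complex.exp (((-((∑ i, ∑ j, k i * k j * fbmCov α (τ i) (τ j)) / 2) : ℝ) : ℂ)) := by
  have hsum : ∀ S : Finset ι, ⇑(pairingLp hν (∑ i ∈ S, k i • fbmKernel hα₀ (τ i)))
      =ᵐ[ν] fun ω => ∑ i ∈ S, k i * hadamardFBm hν α (τ i) ω := by
    classical
    intro S
    induction S using Finset.induction_on with
    | empty =>
      simp only [Finset.sum_empty, map_zero]
      exact Lp.coeFn_zero _ _ _
    | insert i S hi ih =>
      simp only [Finset.sum_insert hi, map_add, map_smul] at ih ⊢
      filter_upwards [ih, Lp.coeFn_add (k i • pairingLp hν (fbmKernel hα₀ (τ i)))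
        (pairingLp hν (∑ i ∈ S, k i • fbmKernel hα₀ (τ i))),
        Lp.coeFn_smul (k i) (pairingLp hν (fbmKernel hα₀ (τ i)))] with ω h1 h2 h3
      rw [h2, Pi.add_apply, h1, h3, Pi.smul_apply, smul_eq_mul, hadamardFBm_eq hν hα₀]
  have h := integral_exp_pairingLp hν (∑ i, k i • fbmKernel hα₀ (τ i))
  rw [← real_inner_self_eq_norm_sq, sum_inner] at h
  simp only [inner_sum, inner_smul_left, inner_smul_right, inner_fbmKernel, conj_trivial] at h
  have h2 : ∫ ω, Complex.exp (Complex.I * ((∑ i, k i * hadamardFBm hν α (τ i) ω : ℝ) : ℂ)) ∂ν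
      = ∫ ω, Complex.exp (Complex.I *
        ((pairingLp hν (∑ i, k i • fbmKernel hα₀ (τ i)) ω : ℝ) : ℂ)) ∂ν := by
    refine integral_congr_ae ?_
    filter_upwards [hsum Finset.univ] with ω hω
    rw [hω]
  rw [h2, h]
  congr 3
  congr 1
  refine Finset.sum_congr rfl fun i _ => Finset.sum_congr rfl fun j _ => ?_
  ring

theorem isSelfSimilar_hadamardFBm {α : ℝ} (hα₀ : 0 < α) :
    IsSelfSimilar (hadamardFBm hν α) (1 / 2) ν := by
  have := hν.isProbabilityMeasure
  intro a ha I
  have ha' : (0 : ℝ) < a := by exact_mod_cast ha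
  have hm1 : Measurable fun ω => I.restrict fun t => hadamardFBm hν α (a * t) ω :=
    measurable_pi_lambda _ fun t => measurable_hadamardFBm hν hα₀ _
  have hm2 : Measurable fun ω => I.restrict fun t => (a : ℝ) ^ (1 / 2 : ℝ) * hadamardFBm hν α t ω :=
    measurable_pi_lambda _ fun t => (measurable_hadamardFBm hν hα₀ _).const_mul _
  refine ⟨hm1.aemeasurable, hm2.aemeasurable, ?_⟩
  have := Measure.isProbabilityMeasure_map (μ := ν) hm1.aemeasurable
  have := Measure.isProbabilityMeasure_map (μ := ν) hm2.aemeasurable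
  refine Measure.ext_of_charFunDual (funext fun L => ?_)
  -- Every linear form on `I → ℝ` is a weighted sum of coordinates, so the characteristic functions
  -- of both laws are covered by `integral_exp_sum_hadamardFBm`.
  have hL : ∀ x : I → ℝ, L x = ∑ i, L (fun j => if i = j then 1 else 0) * x i := fun x => by
    have := LinearMap.pi_apply_eq_sum_univ L.toLinearMap x
    simp only [ContinuousLinearMap.coe_coe, smul_eq_mul] at this
    rw [this]
    exact Finset.sum_congr rfl fun i _ => mul_comm _ _
  set k : I → ℝ := fun i => L (fun j => if i = j then 1 else 0)
  rw [charFunDual_apply, charFunDual_apply, integral_map hm1.aemeasurable (by fun_prop),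
    integral_map hm2.aemeasurable (by fun_prop)]
  have h1 := integral_exp_sum_hadamardFBm hν hα₀ k (fun i => a * (i : ℝ≥0))
  have h2 := integral_exp_sum_hadamardFBm hν hα₀ (fun i => k i * (a : ℝ) ^ (1 / 2 : ℝ))
    (fun i => (i : ℝ≥0))
  have e1 : ∀ ω, L (I.restrict fun t => hadamardFBm hν α (a * t) ω)
      = ∑ i, k i * hadamardFBm hν α (a * (i : ℝ≥0)) ω := fun ω => hL _
  have e2 : ∀ ω, L (I.restrict fun t => (a : ℝ) ^ (1 / 2 : ℝ) * hadamardFBm hν α t ω)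
      = ∑ i, k i * (a : ℝ) ^ (1 / 2 : ℝ) * hadamardFBm hν α (i : ℝ≥0) ω := fun ω => by
    rw [hL]
    refine Finset.sum_congr rfl fun i _ => ?_
    rw [Finset.restrict, mul_assoc]
  simp only [e1, e2, mul_comm _ Complex.I]
  rw [h1, h2]
  congr 3
  congr 1
  refine Finset.sum_congr rfl fun i _ => Finset.sum_congr rfl fun j _ => ?_
  have hsq : (a : ℝ) ^ (1 / 2 : ℝ) * (a : ℝ) ^ (1 / 2 : ℝ) = a := by
    rw [← rpow_add ha']
    norm_num
  rw [NNReal.coe_mul, NNReal.coe_mul, fbmCov_mul α ha']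
  linear_combination (-(k i * k j * fbmCov α (i : ℝ≥0) (j : ℝ≥0))) * hsq

theorem not_hasStationaryIncrements_hadamardFBm {α : ℝ} (hα₀ : 0 < α) (hα₂ : α < 2) (hα : α ≠ 1) :
    ¬ HasStationaryIncrements (hadamardFBm hν α) ν := by
  intro h
  have := hν.isProbabilityMeasure
  -- Equal variances of `B(2) - B(1)` and `B(1) - B(0)` read `3 - 2ρ(log 2) = 1`, that is `ρ(log 2)
  -- = 1 = ρ(0)`. The choice `u = m = 0`, `v = 1`, `L = log 2` below excludes this.
  have hv := (h 0 1 1 zero_le_one).variance_eq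
  have hm : ∀ s t : ℝ≥0, AEMeasurable (fun ω => hadamardFBm hν α t ω - hadamardFBm hν α s ω) ν :=
    fun s t => ((measurable_hadamardFBm hν hα₀ t).sub (measurable_hadamardFBm hν hα₀ s)).aemeasurable
  rw [← covariance_self (hm _ _), ← covariance_self (hm _ _), covariance_increments hν hα₀,
    covariance_increments hν hα₀, fbmCov_self hα₀, fbmCov_self hα₀, fbmCov_self hα₀,
    fbmCov_self hα₀] at hv
  push_cast at hv
  rw [fbmCov_comm α 1 0, fbmCov_zero_left α zero_le_one, zero_add, fbmCov_comm α (1 + 1) 1,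
    fbmCov_of_le α (by norm_num), div_one] at hv
  have h2 := sign_mul_covariance_pos hα₀ hα₂ hα (u := 0) (v := 1) (L := log (1 + 1)) (m := 0)
    (m' := 0) le_rfl one_pos (log_pos (by norm_num)) le_rfl (fun h => absurd rfl h)
  rw [zero_add, logCorrelation_zero hα₀] at h2
  have h3 : logCorrelation α (log (1 + 1)) = 1 := by linarith
  rw [h3] at h2
  simp at h2

theorem integral_exp_increment {α : ℝ} (hα₀ : 0 < α) (hα₂ : α < 2) (hα : α ≠ 1) (s t : ℝ≥0) (k : ℝ) :
    ∫ ω, Complex.exp (Complex.I * ((k * (hadamardFBm hν α t ω - hadamardFBm hν α s ω) : ℝ) : ℂ)) ∂ν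
      = ((exp (-(k ^ 2 / 2) * ((t : ℝ) + s - 2 * Cconst α * min (t : ℝ) s *
          tricomiPsi ((1 - α) / 2) (1 - α) (log (max (t : ℝ) s / min (t : ℝ) s)))) : ℝ) : ℂ) := by
  have h := integral_exp_sum_hadamardFBm hν hα₀ ![k, -k] ![t, s]
  simp only [Fin.sum_univ_two, Matrix.cons_val_zero, Matrix.cons_val_one, fbmCov_self hα₀,
    fbmCov_comm α s t] at h
  -- If the minimum is `0`, the quotient and its logarithm are `0` by convention, and the factor
  -- `min` kills the term in any case.
  have hlog : 0 ≤ log (max (t : ℝ) s / min (t : ℝ) s) := by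
    rcases (le_min t.2 s.2 : (0 : ℝ) ≤ min (t : ℝ) s).eq_or_lt with h0 | h0
    · rw [← h0]
      simp
    · exact log_nonneg ((one_le_div h0).2 min_le_max)
  have hc : fbmCov α t s = Cconst α * min (t : ℝ) s *
      tricomiPsi ((1 - α) / 2) (1 - α) (log (max (t : ℝ) s / min (t : ℝ) s)) := by
    rw [fbmCov, logCorrelation_eq_tricomiPsi hα₀ hα₂ hα hlog]
    ring
  rw [Complex.ofReal_exp]
  calc _ = _ := by
        congr 1
        funext ω
        rw [mul_sub, sub_eq_add_neg, ← neg_mul]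
    _ = _ := h
    _ = _ := by
        congr 2
        rw [hc]
        ring

theorem sign_covariance_increments {α : ℝ} (hα₀ : 0 < α) (hα₂ : α < 2) (hα : α ≠ 1) {u v s t : ℝ≥0}
    (huv : u < v) (hvs : v ≤ s) (hst : s < t) :
    0 < (α - 1) / 2 * cov[fun ω => hadamardFBm hν α t ω - hadamardFBm hν α s ω,
      fun ω => hadamardFBm hν α v ω - hadamardFBm hν α u ω; ν] := by
  have hu : (0 : ℝ) ≤ u := u.2
  have huv' : (u : ℝ) < v := huv
  have hvs' : (v : ℝ) ≤ s := hvs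
  have hst' : (s : ℝ) < t := hst
  have hv : (0 : ℝ) < v := hu.trans_lt huv'
  have hs : (0 : ℝ) < s := hv.trans_le hvs'
  have ht : (0 : ℝ) < t := hs.trans hst'
  -- On the logarithmic scale, passing from `s` to `t` shifts the argument of `ρ` by `L = log(t/s)`,
  -- the same for `x = u` and `x = v`.
  have hlog : ∀ x : ℝ, 0 < x → log (t / x) = log (s / x) + log (t / s) := fun x hx => by
    rw [log_div ht.ne' hx.ne', log_div hs.ne' hx.ne', log_div ht.ne' hs.ne']
    ring
  have key := sign_mul_covariance_pos hα₀ hα₂ hα (L := log (t / s)) (m := log (s / v))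
    (m' := log (s / u)) hu huv' (log_pos ((one_lt_div hs).2 hst'))
    (log_nonneg ((one_le_div hv).2 hvs')) fun h0 => by
      have : (0 : ℝ) < u := lt_of_le_of_ne hu (Ne.symm h0)
      gcongr
  rw [covariance_increments hν hα₀, fbmCov_comm α t v, fbmCov_comm α t u, fbmCov_comm α s v,
    fbmCov_comm α s u, fbmCov_of_le α (hvs'.trans hst'.le), fbmCov_of_le α hvs',
    fbmCov_of_le α (huv'.le.trans (hvs'.trans hst'.le)), fbmCov_of_le α (huv'.le.trans hvs'),
    hlog v hv]
  rcases hu.eq_or_lt with h0 | h0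
  · rw [← h0] at key ⊢
    linarith
  · rw [hlog u h0]
    linarith

end FractionalBrownianMotion

end HadamardFBM

theorem corollary3p2
    (ν : Measure HadamardFBM.TemperedDual) (hν : HadamardFBM.IsWhiteNoise ν)
    (α : ℝ) (hα₀ : 0 < α) (hα₂ : α < 2) :
    HadamardFBM.IsSelfSimilar (HadamardFBM.hadamardFBm hν α) (1 / 2) ν ∧
    (α ≠ 1 →
      ¬ HadamardFBM.HasStationaryIncrements (HadamardFBM.hadamardFBm hν α) ν ∧
      (∀ (s t : ℝ≥0) (k : ℝ),
        ∫ ω, Complex.exp (Complex.I * ((k * (HadamardFBM.hadamardFBm hν α t ω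
            - HadamardFBM.hadamardFBm hν α s ω) : ℝ) : ℂ)) ∂ν
          = ((Real.exp (-(k ^ 2 / 2) * ((t : ℝ) + s - 2 * HadamardFBM.Cconst α * min (t : ℝ) s *
              HadamardFBM.tricomiPsi ((1 - α) / 2) (1 - α)
                (Real.log (max (t : ℝ) s / min (t : ℝ) s)))) : ℝ) : ℂ))) ∧
    (α < 1 → ∀ u v s t : ℝ≥0, u < v → v ≤ s → s < t →
      cov[fun ω => HadamardFBM.hadamardFBm hν α t ω - HadamardFBM.hadamardFBm hν α s ω,
        fun ω => HadamardFBM.hadamardFBm hν α v ω - HadamardFBM.hadamardFBm hν α u ω; ν] < 0) ∧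
    (1 < α → ∀ u v s t : ℝ≥0, u < v → v ≤ s → s < t →
      0 < cov[fun ω => HadamardFBM.hadamardFBm hν α t ω - HadamardFBM.hadamardFBm hν α s ω,
        fun ω => HadamardFBM.hadamardFBm hν α v ω - HadamardFBM.hadamardFBm hν α u ω; ν]) := by
  refine ⟨HadamardFBM.isSelfSimilar_hadamardFBm hν hα₀, fun hα =>
    ⟨HadamardFBM.not_hasStationaryIncrements_hadamardFBm hν hα₀ hα₂ hα,
      HadamardFBM.integral_exp_increment hν hα₀ hα₂ hα⟩, fun hα u v s t huv hvs hst => ?_,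
    fun hα u v s t huv hvs hst => ?_⟩
  · have h := HadamardFBM.sign_covariance_increments hν hα₀ hα₂ hα.ne huv hvs hst
    exact neg_of_mul_pos_right h (by linarith)
  · have h := HadamardFBM.sign_covariance_increments hν hα₀ hα₂ hα.ne' huv hvs hst
    exact (mul_pos_iff_of_pos_left (by linarith)).1 h
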